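/- **Conventions.** A (Čech) closure space is a set $X$ with a map $c\colon 2^X\to 2^X$ such that $c(\emptyset)=\emptyset$, $A\subseteq c(A)$ and $c(A\cup B)=c(A)\cup c(B)$. A map $f\colon (X,c)\to(Y,c')$ is continuous if $f(c(A))\subseteq c'(f(A))$ for all $A\subseteq X$. A set $U$ is a neighbourhood of $x$ if $x\notin c(X\setminus U)$, and $c$ is determined by its neighbourhood filters. Topological spaces are closure spaces through their topological closure. In the product $X\times Y$ the sets $U\times V$, with $U$, $V$ neighbourhoods of $x$, $y$, form a neighbourhood base of $(x,y)$. For $n\ge 0$, $\pi_n(X,x)$ is the set of classes of continuous maps $(S^n,*)\to(X,x)$ modulo homotopies $S^n\times[0,1]\to X$ relative to $*$; for $n\ge1$ it carries the usual group structure. A weak homotopy equivalence is a continuous map $f\colon X\to Y$ such that, for every $x\in X$, the map $\pi_n(f)\colon\pi_n(X,x)\to\pi_n(Y,f(x))$ is a bijection for $n=0$ and an isomorphism of groups for every $n\ge1$, and such that $X\neq\emptyset$ if $Y\neq\emptyset$. Two closure spaces have the same weak homotopy type if they are joined by a finite zig-zag of weak homotopy equivalences. Let $G=(X,E)$ be a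 reflexive undirected graph without multiple edges (possibly infinite, not necessarily locally finite). - $c_G(A)=\bigcup_{x\in A}\{y\mid (x,y)\in E\}$ for $A\subseteq X$. - $VR(X)$ is the simplicial complex whose simplices are the nonempty finite sets of pairwise adjacent vertices, and $|VR(X)|$ is its geometric realization, with the weak (coherent) topology. - $R(X)$ is the closure space on the set $|VR(X)|$ in which the neighbourhoods of a vertex $v$ are the sets containing $\bigcup_{v\in\sigma}|\sigma|$, and every other point has the same neighbourhoods as in $|VR(X)|$. - For a linear order $<$ on $X$, $\Theta_X\colon R(X)\to X$ sends $x$ to the $<$-least vertex among those whose barycentric coordinate at $x$ is maximal. **Theorem.** For every reflexive graph $G=(X,E)$, the closure space $(X,c_G)$ and $|VR(X)|$ have the same weak homotopy type. More precisely, for every linear order on $X$, both maps in $$(X,c_G)\xleftarrow{\ \Theta_X\ }R(X)\xleftarrow{\ \mathrm{id}\ }|VR(X)|$$ are weak homotopy equivalences. -/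

import Mathlib

open Set Filter Topology

universe u v

/-! ## Čech closure spaces -/

/-- A Čech closure operation on a set `X` (not required to be idempotent). -/
@[ext]
structure CechClosure (X : Type u) where
  cl : Set X → Set X
  cl_empty : cl ∅ = ∅
  subset_cl : ∀ A, A ⊆ cl A
  cl_union : ∀ A B, cl (A ∪ B) = cl A ∪ cl B

namespace CechClosure

variable {X : Type u} {Y : Type v}

theorem cl_mono (c : CechClosure X) {A B : Set X} (h : A ⊆ B) : c.cl A ⊆ c.cl B := by
  have := c.cl_union A B
  rw [union_eq_self_of_subset_left h] at this
  rw [this]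
  exact subset_union_left

/-- The neighbourhood filter of `x`: a set `U` is a neighbourhood of `x` iff `x ∉ c (X \ U)`. -/
def nhds (c : CechClosure X) (x : X) : Filter X where
  sets := {U | x ∉ c.cl Uᶜ}
  univ_sets := by simp [c.cl_empty]
  sets_of_superset := fun {U V} hU hUV hx => hU (c.cl_mono (compl_subset_compl.2 hUV) hx)
  inter_sets := fun {U V} hU hV hx => by
    rw [compl_inter, c.cl_union] at hx
    exact hx.elim hU hV

theorem mem_nhds {c : CechClosure X} {x : X} {U : Set X} : U ∈ c.nhds x ↔ x ∉ c.cl Uᶜ := Iff.rfl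

theorem mem_cl_iff {c : CechClosure X} {x : X} {A : Set X} : x ∈ c.cl A ↔ Aᶜ ∉ c.nhds x := by
  rw [mem_nhds, compl_compl, not_not]

theorem ext_nhds {c c' : CechClosure X} (h : ∀ x, c.nhds x = c'.nhds x) : c = c' := by
  ext A x
  rw [mem_cl_iff, mem_cl_iff, h]

/-- Continuity of a map between closure spaces: `f (c A) ⊆ c' (f A)` for all `A`. -/
def IsContinuous (c : CechClosure X) (c' : CechClosure Y) (f : X → Y) : Prop :=
  ∀ A : Set X, f '' c.cl A ⊆ c'.cl (f '' A)

theorem isContinuous_iff {c : CechClosure X} {c' : CechClosure Y} {f : X → Y} :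
    IsContinuous c c' f ↔ ∀ x, Tendsto f (c.nhds x) (c'.nhds (f x)) := by
  constructor
  · intro h x U hU
    rw [mem_map, mem_nhds]
    intro hx
    refine hU (c'.cl_mono ?_ (h _ (mem_image_of_mem f hx)))
    rintro _ ⟨y, hy, rfl⟩
    exact hy
  · rintro h A _ ⟨x, hx, rfl⟩
    rw [mem_cl_iff] at hx ⊢
    intro hU
    refine hx (mem_of_superset (h x hU) ?_)
    intro y hy hyA
    exact hy (mem_image_of_mem f hyA)

/-- The closure operation with prescribed neighbourhood filters. -/
def ofNhds (N : X → Filter X) (hN : ∀ x, pure x ≤ N x) : CechClosure X where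
  cl := fun A => {x | Aᶜ ∉ N x}
  cl_empty := by ext x; simp
  subset_cl := fun A x hx h => (hN x h) hx
  cl_union := fun A B => by
    ext x
    simp only [compl_union, mem_ofPred_eq, mem_union, inter_mem_iff]
    tauto

theorem nhds_ofNhds (N : X → Filter X) (hN : ∀ x, pure x ≤ N x) (x : X) :
    (ofNhds N hN).nhds x = N x := by
  ext U
  simp [mem_nhds, ofNhds]

theorem pure_le_nhds (c : CechClosure X) (x : X) : pure x ≤ c.nhds x := by
  intro U hU
  by_contra hx
  exact hU (c.subset_cl _ hx)

/-- The closure operation of a topological space. -/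
def ofTopology (X : Type u) [TopologicalSpace X] : CechClosure X where
  cl := closure
  cl_empty := closure_empty
  subset_cl := fun _ => subset_closure
  cl_union := fun _ _ => closure_union

theorem nhds_ofTopology [TopologicalSpace X] (x : X) : (ofTopology X).nhds x = 𝓝 x := by
  ext U
  rw [mem_nhds]
  simp only [ofTopology, closure_compl, mem_compl_iff, not_not, mem_interior_iff_mem_nhds]

/-- The product of two closure spaces. -/
def prod (c : CechClosure X) (c' : CechClosure Y) : CechClosure (X × Y) :=
  ofNhds (fun p => c.nhds p.1 ×ˢ c'.nhds p.2) fun p => by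
    rw [← Prod.mk.eta (p := p), ← prod_pure_pure]
    exact Filter.prod_mono (c.pure_le_nhds _) (c'.pure_le_nhds _)

theorem prod_ofTopology [TopologicalSpace X] [TopologicalSpace Y] :
    (ofTopology X).prod (ofTopology Y) = ofTopology (X × Y) := by
  refine ext_nhds fun p => ?_
  rw [prod, nhds_ofNhds, nhds_ofTopology, nhds_ofTopology, nhds_ofTopology, nhds_prod_eq]

theorem isContinuous_ofTopology_iff [TopologicalSpace Y] {c : CechClosure X} {f : Y → X} :
    IsContinuous (ofTopology Y) c f ↔ ∀ y, Tendsto f (𝓝 y) (c.nhds (f y)) := by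
  simp only [isContinuous_iff, nhds_ofTopology]

theorem IsContinuous.comp_continuous {Z : Type*} [TopologicalSpace Y] [TopologicalSpace Z]
    {c : CechClosure X} {f : Y → X} (hf : IsContinuous (ofTopology Y) c f) {g : Z → Y}
    (hg : Continuous g) : IsContinuous (ofTopology Z) c (fun z => f (g z)) := by
  rw [isContinuous_ofTopology_iff] at hf ⊢
  exact fun z => (hf (g z)).comp hg.continuousAt

theorem IsContinuous.comp {Z : Type*} {c : CechClosure X} {d : CechClosure Y} {e : CechClosure Z}
    {g : Y → Z} {f : X → Y} (hg : IsContinuous d e g) (hf : IsContinuous c d f) :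
    IsContinuous c e (fun x => g (f x)) := by
  rw [isContinuous_iff] at hf hg ⊢
  exact fun x => (hg (f x)).comp (hf x)

theorem isContinuous_const [TopologicalSpace Y] (c : CechClosure X) (x : X) :
    IsContinuous (ofTopology Y) c (fun _ => x) := by
  rw [isContinuous_ofTopology_iff]
  exact fun y => tendsto_const_pure.mono_right (c.pure_le_nhds x)

/-- Gluing of two continuous maps along the level set `u = 1/2` of a real function. -/
theorem isContinuous_glue [TopologicalSpace Y] {c : CechClosure X} {f g : Y → X} {w : Y → ℝ}
    (hw : Continuous w) (hf : IsContinuous (ofTopology Y) c f)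
    (hg : IsContinuous (ofTopology Y) c g) (hfg : ∀ y, w y = 1 / 2 → f y = g y) :
    IsContinuous (ofTopology Y) c (fun y => if w y ≤ 1 / 2 then f y else g y) := by
  rw [isContinuous_ofTopology_iff] at hf hg ⊢
  intro y
  rcases lt_trichotomy (w y) (1 / 2) with h | h | h
  · simp only [h.le, if_true]
    refine (hf y).congr' ?_
    filter_upwards [hw.continuousAt.eventually (gt_mem_nhds h)] with z hz
    exact (if_pos (le_of_lt hz)).symm
  · simp only [h.le, if_true]
    have h2 := hg y
    rw [← hfg y h] at h2
    exact Tendsto.if' (hf y) h2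
  · simp only [not_le.2 h, if_false]
    refine (hg y).congr' ?_
    filter_upwards [hw.continuousAt.eventually (lt_mem_nhds h)] with z hz
    rw [if_neg (not_le.2 hz)]

/-- A compact-to-Hausdorff quotient map of topological spaces is a quotient map for maps into
closure spaces. -/
theorem isContinuous_descend {A B : Type*} [TopologicalSpace A] [CompactSpace A]
    [TopologicalSpace B] [T2Space B] {c : CechClosure X} {q : A → B} (hq : Continuous q)
    (hs : Function.Surjective q) {f : B → X}
    (hf : IsContinuous (ofTopology A) c (fun a => f (q a))) :
    IsContinuous (ofTopology B) c f := by
  rw [isContinuous_ofTopology_iff] at hf ⊢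
  intro b U hU
  have hcl : IsClosedMap q := hq.isClosedMap
  set O : Set A := interior {a | f (q a) ∈ U}
  have hO : q ⁻¹' {b} ⊆ O := by
    rintro a rfl
    exact mem_interior_iff_mem_nhds.2 (hf a hU)
  have hV : IsOpen (q '' Oᶜ)ᶜ := (hcl _ isOpen_interior.isClosed_compl).isOpen_compl
  rw [mem_map]
  refine mem_of_superset (hV.mem_nhds (x := b) ?_) ?_
  · rintro ⟨a, ha, rfl⟩
    exact ha (hO rfl)
  · intro b' hb'
    obtain ⟨a, rfl⟩ := hs b'
    have : a ∈ O := by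
      by_contra h
      exact hb' ⟨a, h, rfl⟩
    exact interior_subset (s := {a | f (q a) ∈ U}) this

/-! ## Based maps and homotopy groups -/

/-- Continuous maps from a topological space `A` to a closure space which send `B ⊆ A` to `x`. -/
abbrev PairMap (A : Type v) [TopologicalSpace A] (B : Set A) (c : CechClosure X) (x : X) :
    Type (max u v) :=
  {f : A → X // IsContinuous (ofTopology A) c f ∧ ∀ b ∈ B, f b = x}

/-- Homotopy relative to `B` of maps `(A, B) → (X, x)`. -/
def PairMap.Homotopic {A : Type v} [TopologicalSpace A] {B : Set A} {c : CechClosure X} {x : X}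
    (f g : PairMap A B c x) : Prop :=
  ∃ H : A × unitInterval → X,
    IsContinuous ((ofTopology A).prod (ofTopology unitInterval)) c H ∧
    (∀ a, H (a, 0) = f.1 a) ∧ (∀ a, H (a, 1) = g.1 a) ∧ ∀ b ∈ B, ∀ t, H (b, t) = x

/-- `t ↦ 2t`, truncated at `1`. -/
noncomputable def firstHalf (t : unitInterval) : unitInterval :=
  projIcc 0 1 zero_le_one (2 * (t : ℝ))

/-- `t ↦ 2t - 1`, truncated at `0`. -/
noncomputable def secondHalf (t : unitInterval) : unitInterval :=
  projIcc 0 1 zero_le_one (2 * (t : ℝ) - 1)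

theorem continuous_firstHalf : Continuous firstHalf := by
  unfold firstHalf; exact continuous_projIcc.comp (by fun_prop)

theorem continuous_secondHalf : Continuous secondHalf := by
  unfold secondHalf; exact continuous_projIcc.comp (by fun_prop)

theorem coe_firstHalf (t : unitInterval) : (firstHalf t : ℝ) = max 0 (min 1 (2 * (t : ℝ))) := by
  simp [firstHalf, coe_projIcc]

theorem coe_secondHalf (t : unitInterval) :
    (secondHalf t : ℝ) = max 0 (min 1 (2 * (t : ℝ) - 1)) := by
  simp [secondHalf, coe_projIcc]

theorem firstHalf_of_ge {t : unitInterval} (h : 1 / 2 ≤ (t : ℝ)) : firstHalf t = 1 :=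
  projIcc_of_right_le _ (by linarith)

theorem secondHalf_of_le {t : unitInterval} (h : (t : ℝ) ≤ 1 / 2) : secondHalf t = 0 :=
  projIcc_of_le_left _ (by linarith)

theorem firstHalf_zero : firstHalf 0 = 0 := projIcc_of_le_left _ (by simp)

theorem secondHalf_one : secondHalf 1 = 1 := projIcc_of_right_le _ (by norm_num)

/-- Being homotopic relative to `B` is an equivalence relation. -/
def PairMap.setoid (A : Type v) [TopologicalSpace A] (B : Set A) (c : CechClosure X) (x : X) :
    Setoid (PairMap A B c x) where
  r := PairMap.Homotopic
  iseqv := by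
    refine ⟨fun f => ⟨fun p => f.1 p.1, ?_, fun _ => rfl, fun _ => rfl, fun b hb _ => f.2.2 b hb⟩,
      ?_, ?_⟩
    · rw [prod_ofTopology]
      exact f.2.1.comp_continuous continuous_fst
    · rintro f g ⟨H, hH, h0, h1, hB⟩
      rw [prod_ofTopology] at hH
      refine ⟨fun p => H (p.1, unitInterval.symm p.2), ?_, ?_, ?_, ?_⟩
      · rw [prod_ofTopology]
        exact hH.comp_continuous (by fun_prop)
      · simpa using h1
      · simpa using h0
      · exact fun b hb t => hB b hb _
    · rintro f g k ⟨H, hH, h0, h1, hB⟩ ⟨K, hK, k0, k1, kB⟩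
      rw [prod_ofTopology] at hH hK
      refine ⟨fun p => if (p.2 : ℝ) ≤ 1 / 2 then H (p.1, firstHalf p.2)
        else K (p.1, secondHalf p.2), ?_, ?_, ?_, ?_⟩
      · rw [prod_ofTopology]
        refine isContinuous_glue (by fun_prop)
          (hH.comp_continuous (continuous_fst.prodMk (continuous_firstHalf.comp continuous_snd)))
          (hK.comp_continuous (continuous_fst.prodMk (continuous_secondHalf.comp continuous_snd)))
          ?_
        rintro ⟨a, t⟩ ht
        simp only at ht ⊢
        rw [firstHalf_of_ge ht.ge, secondHalf_of_le ht.le, h1, k0]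
      · intro a
        simp [firstHalf_zero, h0]
      · intro a
        have h : ¬ (((1 : unitInterval) : ℝ) ≤ 1 / 2) := by norm_num
        simp only [if_neg h, secondHalf_one, k1]
      · intro b hb t
        simp only
        split_ifs
        · exact hB b hb _
        · exact kB b hb _

/-- Homotopy classes of maps `(A, B) → (X, x)` relative to `B`. -/
def PairMap.Classes (A : Type v) [TopologicalSpace A] (B : Set A) (c : CechClosure X) (x : X) :
    Type (max u v) :=
  Quotient (PairMap.setoid A B c x)

/-- The unit sphere `S^n` in `ℝ^(n+1)`. -/
abbrev Sphere (n : ℕ) : Type := Metric.sphere (0 : EuclideanSpace ℝ (Fin (n + 1))) 1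

/-- The base point `(1, 0, …, 0)` of `S^n`. -/
noncomputable def Sphere.base (n : ℕ) : Sphere n :=
  ⟨EuclideanSpace.single 0 1, by simp⟩

/-- `π_n(X, x)`: based homotopy classes of continuous maps `(S^n, *) → (X, x)`. -/
def HomotopyGroup (n : ℕ) (c : CechClosure X) (x : X) : Type u :=
  PairMap.Classes (Sphere n) {Sphere.base n} c x

/-- Composition of a map of pairs with a continuous map of closure spaces. -/
def PairMap.postcomp {A : Type*} [TopologicalSpace A] {B : Set A} {c : CechClosure X}
    {c' : CechClosure Y} {f : X → Y} (hf : IsContinuous c c' f) {x : X} (a : PairMap A B c x) :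
    PairMap A B c' (f x) :=
  ⟨fun s => f (a.1 s), hf.comp a.2.1, fun b hb => congrArg f (a.2.2 b hb)⟩

/-- Composition of homotopy classes of maps of pairs with a continuous map of closure spaces. -/
def PairMap.Classes.map {A : Type*} [TopologicalSpace A] {B : Set A} {c : CechClosure X}
    {c' : CechClosure Y} {f : X → Y} (hf : IsContinuous c c' f) (x : X) :
    PairMap.Classes A B c x → PairMap.Classes A B c' (f x) :=
  Quotient.map' (s₁ := PairMap.setoid A B c x) (s₂ := PairMap.setoid A B c' (f x))
    (PairMap.postcomp hf) (by
      rintro a b ⟨H, hH, h0, h1, hB⟩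
      exact ⟨fun p => f (H p), hf.comp hH, fun s => congrArg f (h0 s), fun s => congrArg f (h1 s),
        fun s hs t => congrArg f (hB s hs t)⟩)

/-- The map `π_n(f) : π_n(X, x) → π_n(Y, f x)`. -/
def HomotopyGroup.map (n : ℕ) {c : CechClosure X} {c' : CechClosure Y} {f : X → Y}
    (hf : IsContinuous c c' f) (x : X) : HomotopyGroup n c x → HomotopyGroup n c' (f x) :=
  PairMap.Classes.map hf x

/-! ## The group structure -/

/-- The boundary of the cube `I^n`. -/
def cubeBoundary (n : ℕ) : Set (Fin n → unitInterval) := {t | ∃ i, t i = 0 ∨ t i = 1}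

/-- Homotopy classes of maps `(I^n, ∂I^n) → (X, x)`. -/
abbrev CubeClasses (n : ℕ) (c : CechClosure X) (x : X) : Type u :=
  PairMap.Classes (Fin n → unitInterval) (cubeBoundary n) c x

section Cube

variable {n : ℕ} {c : CechClosure X} {x : X}

theorem update_mem_cubeBoundary {t : Fin (n + 1) → unitInterval} {a : unitInterval}
    (ha : a = 0 ∨ a = 1) : Function.update t 0 a ∈ cubeBoundary (n + 1) :=
  ⟨0, by simpa using ha⟩

theorem update_mem_cubeBoundary' {t : Fin (n + 1) → unitInterval} {a : unitInterval}
    (ht : t ∈ cubeBoundary (n + 1)) (ha : t 0 = 0 ∨ t 0 = 1 → a = 0 ∨ a = 1) :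
    Function.update t 0 a ∈ cubeBoundary (n + 1) := by
  obtain ⟨i, hi⟩ := ht
  by_cases h : i = 0
  · subst h
    exact update_mem_cubeBoundary (ha hi)
  · exact ⟨i, by simpa [Function.update_of_ne h] using hi⟩

theorem firstHalf_endpoint {t : unitInterval} (h : t = 0 ∨ t = 1) :
    firstHalf t = 0 ∨ firstHalf t = 1 := by
  rcases h with rfl | rfl
  · exact Or.inl firstHalf_zero
  · exact Or.inr (firstHalf_of_ge (by norm_num))

theorem secondHalf_endpoint {t : unitInterval} (h : t = 0 ∨ t = 1) :
    secondHalf t = 0 ∨ secondHalf t = 1 := by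
  rcases h with rfl | rfl
  · exact Or.inl (secondHalf_of_le (by norm_num))
  · exact Or.inr secondHalf_one

/-- Concatenation along the first coordinate of the cube. -/
noncomputable def cubeConcatFun (f g : (Fin (n + 1) → unitInterval) → X)
    (t : Fin (n + 1) → unitInterval) : X :=
  if (t 0 : ℝ) ≤ 1 / 2 then f (Function.update t 0 (firstHalf (t 0)))
  else g (Function.update t 0 (secondHalf (t 0)))

/-- Concatenation `f ⋆ g` along the first coordinate of the cube. -/
noncomputable def cubeConcat (f g : PairMap (Fin (n + 1) → unitInterval) (cubeBoundary (n + 1)) c x) :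
    PairMap (Fin (n + 1) → unitInterval) (cubeBoundary (n + 1)) c x :=
  ⟨cubeConcatFun f.1 g.1, by
    refine isContinuous_glue (by fun_prop)
      (f.2.1.comp_continuous
        (continuous_id.update 0 (continuous_firstHalf.comp (continuous_apply 0))))
      (g.2.1.comp_continuous
        (continuous_id.update 0 (continuous_secondHalf.comp (continuous_apply 0)))) ?_
    intro t ht
    rw [f.2.2 _ (update_mem_cubeBoundary (Or.inr (firstHalf_of_ge ht.ge))),
      g.2.2 _ (update_mem_cubeBoundary (Or.inl (secondHalf_of_le ht.le)))], by
    intro t ht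
    unfold cubeConcatFun
    split_ifs
    · exact f.2.2 _ (update_mem_cubeBoundary' ht firstHalf_endpoint)
    · exact g.2.2 _ (update_mem_cubeBoundary' ht secondHalf_endpoint)⟩

/-- Reparametrisations of the first coordinate which are homotopic through maps preserving the
set of endpoints give homotopic maps. -/
theorem reparam_homotopic (F f g : PairMap (Fin (n + 1) → unitInterval) (cubeBoundary (n + 1)) c x)
    (φ : unitInterval × unitInterval → unitInterval) (hφ : Continuous φ)
    (hend : ∀ s t, t = 0 ∨ t = 1 → φ (t, s) = 0 ∨ φ (t, s) = 1)
    (hf : ∀ t, f.1 t = F.1 (Function.update t 0 (φ (t 0, 0))))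
    (hg : ∀ t, g.1 t = F.1 (Function.update t 0 (φ (t 0, 1)))) : PairMap.Homotopic f g := by
  refine ⟨fun p => F.1 (Function.update p.1 0 (φ (p.1 0, p.2))), ?_, fun t => (hf t).symm,
    fun t => (hg t).symm, ?_⟩
  · rw [prod_ofTopology]
    exact F.2.1.comp_continuous (continuous_fst.update 0 (hφ.comp (by fun_prop)))
  · intro t ht s
    exact F.2.2 _ (update_mem_cubeBoundary' ht (hend s _))

/-- The constant map. -/
def cubeOne : PairMap (Fin (n + 1) → unitInterval) (cubeBoundary (n + 1)) c x :=
  ⟨fun _ => x, isContinuous_const c x, fun _ _ => rfl⟩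

/-- Reversal of the first coordinate. -/
def cubeInv (f : PairMap (Fin (n + 1) → unitInterval) (cubeBoundary (n + 1)) c x) :
    PairMap (Fin (n + 1) → unitInterval) (cubeBoundary (n + 1)) c x :=
  ⟨fun t => f.1 (Function.update t 0 (unitInterval.symm (t 0))),
    f.2.1.comp_continuous
      (continuous_id.update 0 (unitInterval.continuous_symm.comp (continuous_apply 0))),
    fun t ht => f.2.2 _ (update_mem_cubeBoundary' ht (by
      rintro (h | h) <;> simp [h]))⟩

theorem cubeConcat_homotopic {f f' g g' : PairMap (Fin (n + 1) → unitInterval) (cubeBoundary (n + 1)) c x}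
    (hf : PairMap.Homotopic f f') (hg : PairMap.Homotopic g g') :
    PairMap.Homotopic (cubeConcat f g) (cubeConcat f' g') := by
  obtain ⟨H, hH, h0, h1, hB⟩ := hf
  obtain ⟨K, hK, k0, k1, kB⟩ := hg
  rw [prod_ofTopology] at hH hK
  refine ⟨fun p => cubeConcatFun (fun t => H (t, p.2)) (fun t => K (t, p.2)) p.1, ?_, ?_, ?_, ?_⟩
  · rw [prod_ofTopology]
    refine isContinuous_glue (by fun_prop)
      (hH.comp_continuous ((continuous_fst.update 0
        (continuous_firstHalf.comp ((continuous_apply 0).comp continuous_fst))).prodMk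
          continuous_snd))
      (hK.comp_continuous ((continuous_fst.update 0
        (continuous_secondHalf.comp ((continuous_apply 0).comp continuous_fst))).prodMk
          continuous_snd)) ?_
    intro p hp
    simp only
    rw [hB _ (update_mem_cubeBoundary (Or.inr (firstHalf_of_ge hp.ge))),
      kB _ (update_mem_cubeBoundary (Or.inl (secondHalf_of_le hp.le)))]
  · intro t
    simp [cubeConcat, cubeConcatFun, h0, k0]
  · intro t
    simp [cubeConcat, cubeConcatFun, h1, k1]
  · intro t ht s
    simp only [cubeConcatFun]
    split_ifs
    · exact hB _ (update_mem_cubeBoundary' ht firstHalf_endpoint) _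
    · exact kB _ (update_mem_cubeBoundary' ht secondHalf_endpoint) _

theorem cubeConcat_one (f : PairMap (Fin (n + 1) → unitInterval) (cubeBoundary (n + 1)) c x) :
    PairMap.Homotopic (cubeConcat cubeOne f) f := by
  refine reparam_homotopic f _ _
    (fun p => projIcc 0 1 zero_le_one
      ((1 - (p.2 : ℝ)) * (secondHalf p.1 : ℝ) + (p.2 : ℝ) * (p.1 : ℝ)))
    (continuous_projIcc.comp ?_) ?_ ?_ ?_
  · have := continuous_secondHalf
    fun_prop
  · rintro s t (rfl | rfl)
    · left
      rw [secondHalf_of_le (by norm_num)]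
      simp
    · right
      rw [secondHalf_one]
      simp
  · intro t
    simp only [cubeConcat, cubeConcatFun, cubeOne]
    split_ifs with h
    · refine (f.2.2 _ (update_mem_cubeBoundary (Or.inl ?_))).symm
      rw [secondHalf_of_le h]
      simp
    · simp
  · intro t
    simp

theorem cubeInv_concat (f : PairMap (Fin (n + 1) → unitInterval) (cubeBoundary (n + 1)) c x) :
    PairMap.Homotopic (cubeConcat (cubeInv f) f) cubeOne := by
  refine reparam_homotopic f _ _
    (fun p => projIcc 0 1 zero_le_one (max |1 - 2 * (p.1 : ℝ)| (p.2 : ℝ)))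
    (continuous_projIcc.comp ?_) ?_ ?_ ?_
  · fun_prop
  · rintro s t (rfl | rfl)
    · right
      exact projIcc_of_right_le _ (by simp)
    · right
      exact projIcc_of_right_le _ (by norm_num)
  · intro t
    have h0 := (t 0).2.1
    have h1 := (t 0).2.2
    simp only [cubeConcat, cubeConcatFun, cubeInv, Function.update_idem, Function.update_self]
    split_ifs with h
    · refine congrArg (fun z => f.1 (Function.update t 0 z)) (Subtype.ext ?_)
      rw [unitInterval.coe_symm_eq, coe_firstHalf, coe_projIcc, Icc.coe_zero,
        max_eq_left (a := |_|) (abs_nonneg _), abs_of_nonneg (by linarith), max_eq_right (by positivity),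
        min_eq_right (by linarith), min_eq_right (by linarith), max_eq_right (by linarith)]
    · push Not at h
      refine congrArg (fun z => f.1 (Function.update t 0 z)) (Subtype.ext ?_)
      rw [coe_secondHalf, coe_projIcc, Icc.coe_zero,
        max_eq_left (a := |_|) (abs_nonneg _), abs_of_nonpos (by linarith)]
      ring_nf
  · intro t
    refine (f.2.2 _ (update_mem_cubeBoundary (Or.inr ?_))).symm
    exact projIcc_of_right_le _ (by simp)

theorem cubeConcat_assoc (f g k : PairMap (Fin (n + 1) → unitInterval) (cubeBoundary (n + 1)) c x) :
    PairMap.Homotopic (cubeConcat (cubeConcat f g) k) (cubeConcat f (cubeConcat g k)) := by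
  refine reparam_homotopic (cubeConcat f (cubeConcat g k)) _ _
    (fun p => projIcc 0 1 zero_le_one
      ((1 - (p.2 : ℝ)) * min (min (2 * (p.1 : ℝ)) ((p.1 : ℝ) + 1 / 4)) (((p.1 : ℝ) + 1) / 2)
        + (p.2 : ℝ) * (p.1 : ℝ)))
    (continuous_projIcc.comp (by fun_prop)) ?_ ?_ ?_
  · rintro s t (rfl | rfl)
    · left
      exact projIcc_of_le_left _ (by norm_num)
    · right
      exact projIcc_of_right_le _ (by norm_num)
  · intro t
    have h0 := (t 0).2.1
    have h1 := (t 0).2.2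
    simp only [Icc.coe_zero, sub_zero, one_mul, zero_mul, add_zero]
    set m : ℝ := min (min (2 * (t 0 : ℝ)) ((t 0 : ℝ) + 1 / 4)) (((t 0 : ℝ) + 1) / 2) with hm
    have hm0 : 0 ≤ m := by
      rw [hm]; refine le_min (le_min ?_ ?_) ?_ <;> linarith
    have hm1 : m ≤ 1 := by
      rw [hm]; exact (min_le_right _ _).trans (by linarith)
    have hmc : ((projIcc (0 : ℝ) 1 zero_le_one m : unitInterval) : ℝ) = m := by
      rw [coe_projIcc, min_eq_right hm1, max_eq_right hm0]
    simp only [cubeConcat, cubeConcatFun, Function.update_idem, Function.update_self, hmc]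
    by_cases ha : (t 0 : ℝ) ≤ 1 / 4
    · have hme : m = 2 * (t 0 : ℝ) := by
        rw [hm, min_eq_left (a := 2 * (t 0 : ℝ)) (by linarith), min_eq_left (by linarith)]
      have hfh : (firstHalf (t 0) : ℝ) = 2 * (t 0 : ℝ) := by
        rw [coe_firstHalf, min_eq_right (by linarith), max_eq_right (by linarith)]
      rw [if_pos (by linarith), if_pos (by linarith), if_pos (by linarith)]
      refine congrArg (fun z => f.1 (Function.update t 0 z)) (Subtype.ext ?_)
      rw [coe_firstHalf, hfh, coe_firstHalf, hmc, hme]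
    · push Not at ha
      by_cases hb : (t 0 : ℝ) ≤ 1 / 2
      · have hme : m = (t 0 : ℝ) + 1 / 4 := by
          rw [hm, min_eq_right (a := 2 * (t 0 : ℝ)) (by linarith), min_eq_left (by linarith)]
        have hfh : (firstHalf (t 0) : ℝ) = 2 * (t 0 : ℝ) := by
          rw [coe_firstHalf, min_eq_right (by linarith), max_eq_right (by linarith)]
        have hsh : (secondHalf (projIcc (0 : ℝ) 1 zero_le_one m) : ℝ) = 2 * (t 0 : ℝ) - 1 / 2 := by
          rw [coe_secondHalf, hmc, hme, min_eq_right (by linarith), max_eq_right (by linarith)]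
          ring
        rw [if_pos hb, if_neg (by linarith), if_neg (by linarith), if_pos (by linarith)]
        refine congrArg (fun z => g.1 (Function.update t 0 z)) (Subtype.ext ?_)
        rw [coe_secondHalf, hfh, coe_firstHalf, hsh]
        ring_nf
      · push Not at hb
        have hme : m = ((t 0 : ℝ) + 1) / 2 := by
          rw [hm, min_eq_right (by
            refine le_min ?_ ?_ <;> linarith)]
        have hsh : (secondHalf (projIcc (0 : ℝ) 1 zero_le_one m) : ℝ) = (t 0 : ℝ) := by
          rw [coe_secondHalf, hmc, hme, min_eq_right (by linarith), max_eq_right (by linarith)]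
          ring
        rw [if_neg (by linarith), if_neg (by linarith), if_neg (by linarith)]
        refine congrArg (fun z => k.1 (Function.update t 0 z)) (Subtype.ext ?_)
        rw [coe_secondHalf, coe_secondHalf, hsh]
  · intro t
    simp

/-- The group of homotopy classes of maps `(I^(n+1), ∂I^(n+1)) → (X, x)`. -/
noncomputable instance cubeGroup : Group (CubeClasses (n + 1) c x) :=
  letI : Mul (CubeClasses (n + 1) c x) :=
    ⟨Quotient.map₂ cubeConcat (fun _ _ hf _ _ hg => cubeConcat_homotopic hf hg)⟩
  letI : One (CubeClasses (n + 1) c x) := ⟨Quotient.mk _ cubeOne⟩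
  letI : Inv (CubeClasses (n + 1) c x) :=
    ⟨Quotient.map cubeInv (by
      rintro f g ⟨H, hH, h0, h1, hB⟩
      rw [prod_ofTopology] at hH
      refine ⟨fun p => H (Function.update p.1 0 (unitInterval.symm (p.1 0)), p.2), ?_, ?_, ?_, ?_⟩
      · rw [prod_ofTopology]
        exact hH.comp_continuous ((continuous_fst.update 0
          (unitInterval.continuous_symm.comp ((continuous_apply 0).comp continuous_fst))).prodMk
          continuous_snd)
      · exact fun t => h0 _
      · exact fun t => h1 _
      · exact fun t ht s => hB _ (update_mem_cubeBoundary' ht (by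
          rintro (h | h) <;> simp [h])) s)⟩
  Group.ofLeftAxioms
    (by
      rintro ⟨f⟩ ⟨g⟩ ⟨k⟩
      exact Quotient.sound (cubeConcat_assoc f g k))
    (by
      rintro ⟨f⟩
      exact Quotient.sound (cubeConcat_one f))
    (by
      rintro ⟨f⟩
      exact Quotient.sound (cubeInv_concat f))

end Cube

/-! ### The collapse `I^n → I^n / ∂I^n ≅ S^n` -/

/-- `t ↦ 2t - 1`, coordinatewise, from `I^n` to `[-1,1]^n`. -/
def cubeCentre {n : ℕ} (t : Fin n → unitInterval) : Fin n → ℝ := fun i => 2 * (t i : ℝ) - 1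

theorem continuous_cubeCentre {n : ℕ} : Continuous (cubeCentre (n := n)) := by
  unfold cubeCentre; fun_prop

/-- The distance `1 - ‖u‖_∞` from `u = 2t - 1` to the boundary of `[-1,1]^n`. -/
noncomputable def cubeDepth {n : ℕ} (t : Fin n → unitInterval) : ℝ := 1 - ‖cubeCentre t‖

theorem continuous_cubeDepth {n : ℕ} : Continuous (cubeDepth (n := n)) := by
  unfold cubeDepth; exact continuous_const.sub continuous_cubeCentre.norm

theorem collapse_denom_pos {n : ℕ} (t : Fin n → unitInterval) :
    0 < ∑ i, cubeCentre t i ^ 2 + cubeDepth t ^ 2 := by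
  by_cases h : cubeCentre t = 0
  · have : cubeDepth t = 1 := by simp [cubeDepth, h]
    rw [this]
    have : 0 ≤ ∑ i, cubeCentre t i ^ 2 := Finset.sum_nonneg fun i _ => sq_nonneg _
    linarith
  · obtain ⟨i, hi⟩ := Function.ne_iff.1 h
    have : 0 < ∑ i, cubeCentre t i ^ 2 :=
      Finset.sum_pos' (fun i _ => sq_nonneg _) ⟨i, Finset.mem_univ _, pow_pos_of_ne hi⟩
    have := sq_nonneg (cubeDepth t)
    linarith
where
  pow_pos_of_ne {r : ℝ} (h : r ≠ (0 : ℝ)) : 0 < r ^ 2 := by positivity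

/-- The relative homeomorphism `(I^n, ∂I^n) → (S^n, *)`: the homeomorphism `u ↦ u / (1 - ‖u‖_∞)`
from the open cube to `ℝ^n`, followed by inverse stereographic projection. -/
noncomputable def collapse {n : ℕ} (t : Fin n → unitInterval) : Sphere n :=
  ⟨WithLp.toLp 2 (Fin.cons
      ((∑ i, cubeCentre t i ^ 2 - cubeDepth t ^ 2) / (∑ i, cubeCentre t i ^ 2 + cubeDepth t ^ 2))
      fun i => 2 * cubeDepth t * cubeCentre t i / (∑ i, cubeCentre t i ^ 2 + cubeDepth t ^ 2)), by
    have hp := collapse_denom_pos t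
    rw [mem_sphere_zero_iff_norm, EuclideanSpace.norm_eq, Real.sqrt_eq_one, Fin.sum_univ_succ]
    simp only [Fin.cons_zero, Fin.cons_succ, Real.norm_eq_abs, sq_abs, div_pow, mul_pow]
    rw [← Finset.sum_div, ← Finset.mul_sum, ← add_div, div_eq_one_iff_eq (by positivity)]
    ring⟩

theorem continuous_collapse {n : ℕ} : Continuous (collapse (n := n)) := by
  have h1 : Continuous (cubeDepth (n := n)) := continuous_cubeDepth
  have h2 : ∀ i, Continuous fun t : Fin n → unitInterval => cubeCentre t i :=
    fun i => (continuous_apply i).comp continuous_cubeCentre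
  have hd : ∀ t : Fin n → unitInterval, ∑ i, cubeCentre t i ^ 2 + cubeDepth t ^ 2 ≠ 0 :=
    fun t => (collapse_denom_pos t).ne'
  refine Continuous.subtype_mk ((PiLp.continuous_toLp 2 _).comp (continuous_pi fun i => ?_)) _
  refine Fin.cases ?_ (fun i => ?_) i
  · simp only [Fin.cons_zero]
    exact Continuous.div (by fun_prop) (by fun_prop) hd
  · simp only [Fin.cons_succ]
    exact Continuous.div (by fun_prop) (by fun_prop) hd

theorem mem_cubeBoundary_iff {n : ℕ} (t : Fin n → unitInterval) :
    t ∈ cubeBoundary n ↔ cubeDepth t = 0 := by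
  have hle : ∀ i, |cubeCentre t i| ≤ 1 := fun i => by
    have h0 := (t i).2.1
    have h1 := (t i).2.2
    rw [abs_le]
    constructor <;> simp only [cubeCentre] <;> linarith
  have key : ∀ i, |cubeCentre t i| = 1 ↔ t i = 0 ∨ t i = 1 := fun i => by
    rw [abs_eq (zero_le_one), Subtype.ext_iff, Subtype.ext_iff]
    simp only [cubeCentre, Icc.coe_zero, Icc.coe_one]
    constructor
    · rintro (h | h)
      · right; linarith
      · left; linarith
    · rintro (h | h)
      · right; linarith
      · left; linarith
  rw [cubeDepth, sub_eq_zero]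
  constructor
  · rintro ⟨i, hi⟩
    refine le_antisymm ?_ ?_
    · rw [← (key i).2 hi]
      exact norm_le_pi_norm (cubeCentre t) i
    · exact (pi_norm_le_iff_of_nonneg zero_le_one).2 hle
  · intro h
    by_contra hne
    have : ‖cubeCentre t‖ < 1 := (pi_norm_lt_iff zero_lt_one).2 fun i =>
      lt_of_le_of_ne (hle i) fun hi => hne ⟨i, (key i).1 hi⟩
    linarith

theorem cubeDepth_nonneg {n : ℕ} (t : Fin n → unitInterval) : 0 ≤ cubeDepth t := by
  rw [cubeDepth, sub_nonneg, pi_norm_le_iff_of_nonneg zero_le_one]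
  intro i
  have h0 := (t i).2.1
  have h1 := (t i).2.2
  rw [Real.norm_eq_abs, abs_le]
  constructor <;> simp only [cubeCentre] <;> linarith

theorem collapse_apply_zero {n : ℕ} (t : Fin n → unitInterval) :
    (collapse t).1 0 =
      (∑ i, cubeCentre t i ^ 2 - cubeDepth t ^ 2) / (∑ i, cubeCentre t i ^ 2 + cubeDepth t ^ 2) :=
  rfl

theorem collapse_apply_succ {n : ℕ} (t : Fin n → unitInterval) (i : Fin n) :
    (collapse t).1 i.succ =
      2 * cubeDepth t * cubeCentre t i / (∑ i, cubeCentre t i ^ 2 + cubeDepth t ^ 2) :=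
  rfl

theorem eq_base_iff {n : ℕ} (p : Sphere n) : p = Sphere.base n ↔ p.1 0 = 1 := by
  constructor
  · rintro rfl
    simp [Sphere.base]
  · intro h
    have hn := p.2
    rw [mem_sphere_zero_iff_norm, EuclideanSpace.norm_eq, Real.sqrt_eq_one, Fin.sum_univ_succ, h]
      at hn
    simp only [Real.norm_eq_abs, sq_abs, one_pow, add_eq_left] at hn
    rw [Finset.sum_eq_zero_iff_of_nonneg (fun i _ => sq_nonneg _)] at hn
    ext i
    refine Fin.cases ?_ (fun i => ?_) i
    · simpa [Sphere.base] using h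
    · have := hn i (Finset.mem_univ _)
      simp only [ne_eq, OfNat.ofNat_ne_zero, not_false_eq_true, pow_eq_zero_iff] at this
      simp [Sphere.base, this]

theorem collapse_eq_base_iff {n : ℕ} (t : Fin n → unitInterval) :
    collapse t = Sphere.base n ↔ t ∈ cubeBoundary n := by
  have hp := collapse_denom_pos t
  rw [eq_base_iff, collapse_apply_zero, mem_cubeBoundary_iff, div_eq_one_iff_eq hp.ne']
  constructor
  · intro h
    have : cubeDepth t ^ 2 = 0 := by linarith
    simpa using this
  · intro h
    simp [h]

/-- Stereographic projection of `collapse t` recovers `u / (1 - ‖u‖_∞)`. -/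
theorem stereo_collapse {n : ℕ} (t : Fin n → unitInterval) (ht : t ∉ cubeBoundary n) (i : Fin n) :
    (collapse t).1 i.succ / (1 - (collapse t).1 0) = cubeCentre t i / cubeDepth t := by
  have hp := collapse_denom_pos t
  have ha : cubeDepth t ≠ 0 := fun h => ht ((mem_cubeBoundary_iff t).2 h)
  have h1 : 1 - (collapse t).1 0 =
      2 * cubeDepth t ^ 2 / (∑ i, cubeCentre t i ^ 2 + cubeDepth t ^ 2) := by
    rw [collapse_apply_zero]
    field_simp
    ring
  rw [h1, collapse_apply_succ]
  field_simp

theorem collapse_injOn {n : ℕ} {s t : Fin n → unitInterval} (hs : s ∉ cubeBoundary n)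
    (h : collapse s = collapse t) : s = t := by
  have ht : t ∉ cubeBoundary n := by
    rw [← collapse_eq_base_iff] at hs ⊢
    rwa [← h]
  have hs0 : 0 < cubeDepth s := lt_of_le_of_ne (cubeDepth_nonneg s)
    fun h => hs ((mem_cubeBoundary_iff s).2 h.symm)
  have ht0 : 0 < cubeDepth t := lt_of_le_of_ne (cubeDepth_nonneg t)
    fun h => ht ((mem_cubeBoundary_iff t).2 h.symm)
  have hw : (cubeDepth s)⁻¹ • cubeCentre s = (cubeDepth t)⁻¹ • cubeCentre t := by
    ext i
    have := stereo_collapse s hs i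
    rw [h, stereo_collapse t ht i] at this
    simp only [Pi.smul_apply, smul_eq_mul]
    rw [inv_mul_eq_div, inv_mul_eq_div, this]
  have hd : cubeDepth s = cubeDepth t := by
    have hn := congrArg norm hw
    rw [norm_smul, norm_smul, norm_inv, norm_inv, Real.norm_of_nonneg hs0.le,
      Real.norm_of_nonneg ht0.le] at hn
    have e1 : ‖cubeCentre s‖ = 1 - cubeDepth s := by simp [cubeDepth]
    have e2 : ‖cubeCentre t‖ = 1 - cubeDepth t := by simp [cubeDepth]
    rw [e1, e2] at hn
    field_simp at hn
    linarith
  rw [hd] at hw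
  have hc : cubeCentre s = cubeCentre t := smul_right_injective _ (inv_ne_zero ht0.ne') hw
  ext i
  have := congrFun hc i
  simp only [cubeCentre] at this
  linarith

theorem collapse_surjective {n : ℕ} (hn : n ≠ 0) : Function.Surjective (collapse (n := n)) := by
  intro p
  by_cases hp : p = Sphere.base n
  · subst hp
    refine ⟨fun _ => 0, (collapse_eq_base_iff _).2 ⟨⟨0, Nat.pos_of_ne_zero hn⟩, Or.inl rfl⟩⟩
  · have hsum : p.1 0 ^ 2 + ∑ i : Fin n, p.1 i.succ ^ 2 = 1 := by
      have h := p.2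
      rw [mem_sphere_zero_iff_norm, EuclideanSpace.norm_eq, Real.sqrt_eq_one,
        Fin.sum_univ_succ] at h
      simpa only [Real.norm_eq_abs, sq_abs] using h
    have hnn : 0 ≤ ∑ i : Fin n, p.1 i.succ ^ 2 := Finset.sum_nonneg fun i _ => sq_nonneg _
    have hlt : p.1 0 < 1 := lt_of_le_of_ne (by nlinarith) fun h => hp ((eq_base_iff p).2 h)
    have hD : 0 < 1 - p.1 0 := by linarith
    set w : Fin n → ℝ := fun i => p.1 i.succ / (1 - p.1 0) with hw
    set N : ℝ := 1 + ‖w‖ with hN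
    have hNpos : 0 < N := by positivity
    have hwi : ∀ i, |w i| ≤ N := fun i => (norm_le_pi_norm w i).trans (by linarith)
    let t : Fin n → unitInterval := fun i => ⟨(1 + w i / N) / 2, by
      have h1 : |w i / N| ≤ 1 := by
        rw [abs_div, abs_of_pos hNpos]
        exact (div_le_one hNpos).2 (hwi i)
      rw [abs_le] at h1
      constructor <;> linarith [h1.1, h1.2]⟩
    have hc : cubeCentre t = N⁻¹ • w := by
      ext i
      simp only [cubeCentre, t, Pi.smul_apply, smul_eq_mul]
      ring
    have hd : cubeDepth t = N⁻¹ := by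
      rw [cubeDepth, hc, norm_smul, norm_inv, Real.norm_of_nonneg hNpos.le]
      field_simp
      rw [hN]; ring
    have hS : ∑ i, cubeCentre t i ^ 2 = N⁻¹ ^ 2 * ((1 + p.1 0) / (1 - p.1 0)) := by
      have : ∀ i, cubeCentre t i ^ 2 = N⁻¹ ^ 2 * (p.1 i.succ ^ 2 / (1 - p.1 0) ^ 2) := fun i => by
        rw [hc]; simp only [Pi.smul_apply, smul_eq_mul, hw]; rw [mul_pow, div_pow]
      simp only [this]
      rw [← Finset.mul_sum, ← Finset.sum_div]
      congr 1
      rw [div_eq_div_iff (by positivity) hD.ne']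
      have : ∑ i : Fin n, p.1 i.succ ^ 2 = (1 - p.1 0) * (1 + p.1 0) := by linarith
      rw [this]; ring
    have hden : ∑ i, cubeCentre t i ^ 2 + cubeDepth t ^ 2 = N⁻¹ ^ 2 * (2 / (1 - p.1 0)) := by
      rw [hS, hd]; field_simp; ring
    refine ⟨t, ?_⟩
    ext i
    refine Fin.cases ?_ (fun i => ?_) i
    · rw [collapse_apply_zero, hden, hS, hd]
      field_simp
      ring
    · rw [collapse_apply_succ, hden, hd, hc]
      simp only [Pi.smul_apply, smul_eq_mul, hw]
      field_simp

/-- Composition with the collapse map, from maps on `(S^n, *)` to maps on `(I^n, ∂I^n)`. -/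
noncomputable def toCube {n : ℕ} {c : CechClosure X} {x : X}
    (f : PairMap (Sphere n) {Sphere.base n} c x) :
    PairMap (Fin n → unitInterval) (cubeBoundary n) c x :=
  ⟨fun t => f.1 (collapse t), f.2.1.comp_continuous continuous_collapse,
    fun t ht => f.2.2 _ ((collapse_eq_base_iff t).2 ht)⟩

/-- Composition with the collapse map `I^n → S^n`, on homotopy classes. -/
noncomputable def HomotopyGroup.toCubeClasses (n : ℕ) (c : CechClosure X) (x : X) :
    HomotopyGroup n c x → CubeClasses n c x :=
  Quotient.map' (s₁ := PairMap.setoid (Sphere n) {Sphere.base n} c x)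
    (s₂ := PairMap.setoid (Fin n → unitInterval) (cubeBoundary n) c x) toCube (by
      rintro f g ⟨H, hH, h0, h1, hB⟩
      rw [prod_ofTopology] at hH
      refine ⟨fun p => H (collapse p.1, p.2), ?_, fun t => h0 _, fun t => h1 _,
        fun t ht s => hB _ ((collapse_eq_base_iff t).2 ht) s⟩
      rw [prod_ofTopology]
      exact hH.comp_continuous
        ((continuous_collapse.comp continuous_fst).prodMk continuous_snd))

theorem collapse_fibre {n : ℕ} {A : Type*} {x : A} {F : (Fin n → unitInterval) → A}
    (hF : ∀ t ∈ cubeBoundary n, F t = x) {s t : Fin n → unitInterval}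
    (h : collapse s = collapse t) : F s = F t := by
  by_cases hs : s ∈ cubeBoundary n
  · have ht : t ∈ cubeBoundary n := by
      rw [← collapse_eq_base_iff] at hs ⊢
      rw [← h, hs]
    rw [hF s hs, hF t ht]
  · rw [collapse_injOn hs h]

theorem HomotopyGroup.toCubeClasses_bijective (n : ℕ) (c : CechClosure X) (x : X) :
    Function.Bijective (toCubeClasses (n + 1) c x) := by
  have hsurj : Function.Surjective (collapse (n := n + 1)) := collapse_surjective n.succ_ne_zero
  constructor
  · rintro ⟨f⟩ ⟨g⟩ h
    obtain ⟨H, hH, h0, h1, hB⟩ := Quotient.exact h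
    rw [prod_ofTopology] at hH
    let K : Sphere (n + 1) × unitInterval → X :=
      fun p => H (Function.surjInv hsurj p.1, p.2)
    have hK : ∀ t s, K (collapse t, s) = H (t, s) := fun t s =>
      collapse_fibre (F := fun t => H (t, s)) (fun t ht => hB t ht s)
        (Function.surjInv_eq hsurj (collapse t))
    refine Quotient.sound ⟨K, ?_, ?_, ?_, ?_⟩
    · rw [prod_ofTopology]
      refine isContinuous_descend
        (q := fun p : (Fin (n + 1) → unitInterval) × unitInterval => (collapse p.1, p.2))
        ((continuous_collapse.comp continuous_fst).prodMk continuous_snd) ?_ ?_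
      · rintro ⟨p, s⟩
        obtain ⟨t, rfl⟩ := hsurj p
        exact ⟨(t, s), rfl⟩
      · simpa only [hK] using hH
    · intro p
      obtain ⟨t, rfl⟩ := hsurj p
      rw [hK]; exact h0 t
    · intro p
      obtain ⟨t, rfl⟩ := hsurj p
      rw [hK]; exact h1 t
    · intro p hp s
      obtain ⟨t, rfl⟩ := hsurj p
      rw [hK]; exact hB t ((collapse_eq_base_iff t).1 hp) s
  · rintro ⟨F⟩
    have hf : ∀ t, F.1 (Function.surjInv hsurj (collapse t)) = F.1 t := fun t =>
      collapse_fibre F.2.2 (Function.surjInv_eq hsurj (collapse t))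
    refine ⟨Quotient.mk _ ⟨fun p => F.1 (Function.surjInv hsurj p),
      isContinuous_descend continuous_collapse hsurj (by simpa only [hf] using F.2.1), ?_⟩, ?_⟩
    · intro p hp
      obtain ⟨t, rfl⟩ := hsurj p
      simp only [hf]
      exact F.2.2 t ((collapse_eq_base_iff t).1 hp)
    · exact congrArg (Quotient.mk _) (Subtype.ext (funext hf))

/-- Based maps on `S^n` and maps on `(I^n, ∂I^n)` have the same homotopy classes, for `n ≥ 1`. -/
noncomputable def HomotopyGroup.equivCubeClasses (n : ℕ) (c : CechClosure X) (x : X) :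
    HomotopyGroup (n + 1) c x ≃ CubeClasses (n + 1) c x :=
  Equiv.ofBijective _ (toCubeClasses_bijective n c x)

/-- The usual group structure on `π_n(X, x)` for `n ≥ 1`: concatenation along the first coordinate
of the cube, under the identification `I^n / ∂I^n ≅ S^n`. -/
noncomputable instance HomotopyGroup.instGroup (n : ℕ) (c : CechClosure X) (x : X) :
    Group (HomotopyGroup (n + 1) c x) :=
  (equivCubeClasses n c x).group

theorem HomotopyGroup.equivCubeClasses_mul (n : ℕ) (c : CechClosure X) (x : X)
    (a b : HomotopyGroup (n + 1) c x) :
    equivCubeClasses n c x (a * b) = equivCubeClasses n c x a * equivCubeClasses n c x b :=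
  (Equiv.mulEquiv (equivCubeClasses n c x)).map_mul a b

/-- The homomorphism `π_n(f) : π_n(X, x) → π_n(Y, f x)` for `n ≥ 1`. -/
noncomputable def HomotopyGroup.mapHom (n : ℕ) {c : CechClosure X} {c' : CechClosure Y} {f : X → Y}
    (hf : IsContinuous c c' f) (x : X) :
    HomotopyGroup (n + 1) c x →* HomotopyGroup (n + 1) c' (f x) :=
  MonoidHom.mk' (HomotopyGroup.map (n + 1) hf x) (by
    have hnat : ∀ a : HomotopyGroup (n + 1) c x,
        equivCubeClasses n c' (f x) (HomotopyGroup.map (n + 1) hf x a) =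
          PairMap.Classes.map hf x (equivCubeClasses n c x a) := by
      rintro ⟨a⟩
      rfl
    have hmul : ∀ a b : CubeClasses (n + 1) c x,
        PairMap.Classes.map hf x (a * b) =
          PairMap.Classes.map hf x a * PairMap.Classes.map hf x b := by
      rintro ⟨a⟩ ⟨b⟩
      refine congrArg (Quotient.mk _) (Subtype.ext (funext fun t => ?_))
      simp only [PairMap.postcomp, cubeConcat, cubeConcatFun]
      split_ifs <;> rfl
    intro a b
    apply (equivCubeClasses n c' (f x)).injective
    rw [hnat, equivCubeClasses_mul, hmul, equivCubeClasses_mul, hnat, hnat])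

/-! ## Weak homotopy equivalences -/

/-- A weak homotopy equivalence: a continuous map inducing, at every base point, a bijection on
`π_0` and an isomorphism on `π_n` for all `n ≥ 1`. As `π_0` is pointed, the last clause is needed
to say that the empty space is weakly equivalent only to itself. -/
def IsWeakHomotopyEquiv (c : CechClosure X) (c' : CechClosure Y) (f : X → Y) : Prop :=
  ∃ hf : IsContinuous c c' f,
    (∀ x, Function.Bijective (HomotopyGroup.map 0 hf x)) ∧
    (∀ n x, Function.Bijective (HomotopyGroup.mapHom n hf x)) ∧
    (Nonempty Y → Nonempty X)

end CechClosure

/-- A closure space, bundled. -/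
structure CechSpace where
  carrier : Type u
  closure : CechClosure carrier

/-- Two closure spaces have the same weak homotopy type if they are joined by a finite zig-zag of
weak homotopy equivalences. -/
def SameWeakHomotopyType (P Q : CechSpace.{u}) : Prop :=
  Relation.EqvGen (fun P Q : CechSpace.{u} => ∃ f : P.carrier → Q.carrier,
    CechClosure.IsWeakHomotopyEquiv P.closure Q.closure f) P Q

/-! ## Geometric realization -/

section Realization

variable {V : Type u}

/-- The points of the geometric realization `|K|`: barycentric coordinates, supported on a
simplex. -/
structure Realization (K : AbstractSimplicialComplex V) where
  coord : V →₀ ℝ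
  coord_nonneg : ∀ v, 0 ≤ coord v
  sum_coord : ∑ v ∈ coord.support, coord v = 1
  support_mem : coord.support ∈ K.faces

/-- The closed simplex `|σ|`. -/
def Realization.face (K : AbstractSimplicialComplex V) (σ : Finset V) : Set (Realization K) :=
  {x | x.coord.support ⊆ σ}

/-- The Euclidean topology of `|σ|` (induced by the barycentric coordinates). -/
abbrev Realization.faceTopology (K : AbstractSimplicialComplex V) (σ : Finset V) :
    TopologicalSpace (Realization.face K σ) :=
  TopologicalSpace.induced (fun x (v : V) => x.1.coord v) inferInstance

/-- The weak (coherent) topology: a set is open iff its trace on every `|σ|` is open. -/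
instance Realization.topology (K : AbstractSimplicialComplex V) :
    TopologicalSpace (Realization K) :=
  ⨆ σ : K.faces, TopologicalSpace.coinduced
    (Subtype.val : Realization.face K σ.1 → Realization K) (Realization.faceTopology K σ.1)

/-- The vertex `v`, as a point of `|K|`. -/
noncomputable def Realization.vertex (K : AbstractSimplicialComplex V) (v : V) : Realization K :=
  ⟨Finsupp.single v 1, fun w => by
      classical
      rw [Finsupp.single_apply]; split_ifs <;> norm_num,
    by rw [Finsupp.support_single v one_ne_zero]; simp, by
      rw [Finsupp.support_single v one_ne_zero]
      exact K.singleton_mem v⟩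

end Realization

/-! ## Reflexive graphs -/

/-- A reflexive undirected graph without multiple edges, on a vertex set of any cardinality. -/
structure ReflexiveGraph (X : Type u) where
  Adj : X → X → Prop
  refl : ∀ x, Adj x x
  symm : ∀ x y, Adj x y → Adj y x

namespace ReflexiveGraph

variable {X : Type u} (G : ReflexiveGraph X)

/-- The canonical closure `c_G(A) = ⋃_{x ∈ A} {y | (x, y) ∈ E}`. -/
def closure : CechClosure X where
  cl := fun A => ⋃ x ∈ A, {y | G.Adj x y}
  cl_empty := by simp
  subset_cl := fun A x hx => mem_biUnion hx (G.refl x)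
  cl_union := fun A B => biUnion_union A B _

/-- The Vietoris–Rips (clique) complex. -/
def vietorisRips : AbstractSimplicialComplex X where
  faces := {σ | σ.Nonempty ∧ ∀ v ∈ σ, ∀ w ∈ σ, G.Adj v w}
  isRelLowerSet_faces := fun _ hσ =>
    ⟨hσ.1, fun _ hτ hne => ⟨hne, fun v hv w hw => hσ.2 v (hτ hv) w (hτ hw)⟩⟩
  singleton_mem := fun v => ⟨Finset.singleton_nonempty v, fun a ha b hb => by
    rw [Finset.mem_singleton] at ha hb
    subst ha; subst hb
    exact G.refl _⟩

/-- `|VR(X)|` with its topological closure. -/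
def vrClosure : CechClosure (Realization G.vietorisRips) :=
  CechClosure.ofTopology (Realization G.vietorisRips)

open Classical in
/-- The neighbourhood filters of `R(X)`: at a vertex `v`, the principal filter of the union of the
closed simplices containing `v`; elsewhere, the neighbourhood filter of `|VR(X)|`. -/
noncomputable def rNhds (x : Realization G.vietorisRips) : Filter (Realization G.vietorisRips) :=
  if ∃ v, x = Realization.vertex G.vietorisRips v then
    𝓟 (⋃ σ ∈ {σ | σ ∈ G.vietorisRips.faces ∧ ∃ v ∈ σ, x = Realization.vertex G.vietorisRips v},
      Realization.face G.vietorisRips σ)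
  else 𝓝 x

theorem pure_le_rNhds (x : Realization G.vietorisRips) : pure x ≤ G.rNhds x := by
  unfold rNhds
  split_ifs with h
  · obtain ⟨v, rfl⟩ := h
    refine le_principal_iff.2 (mem_pure.2 ?_)
    refine mem_biUnion (x := {v}) ⟨G.vietorisRips.singleton_mem v, v, by simp, rfl⟩ ?_
    exact (Finsupp.support_single v one_ne_zero).le
  · exact _root_.pure_le_nhds x

/-- The closure operation of `R(X)`, on the same underlying set as `|VR(X)|`. -/
noncomputable def rClosure : CechClosure (Realization G.vietorisRips) :=
  CechClosure.ofNhds G.rNhds G.pure_le_rNhds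

theorem exists_max_coordinate (x : Realization G.vietorisRips) :
    ∃ v ∈ x.coord.support, ∀ w, x.coord w ≤ x.coord v := by
  obtain ⟨v, hv, hmax⟩ := x.coord.support.exists_max_image x.coord x.support_mem.1
  refine ⟨v, hv, fun w => ?_⟩
  by_cases hw : w ∈ x.coord.support
  · exact hmax w hw
  · rw [Finsupp.notMem_support_iff.1 hw]
    exact x.coord_nonneg v

open Classical in
/-- The discrete modification `Θ : R(X) → X` for a linear order on the vertices. The barycentric
cover of a simplex `{v_0, …, v_n}` consists of the sets `A_i` of those points whose `i`-th
barycentric coordinate is maximal, and `Θ x` is the least vertex `v_i` with `x ∈ A_i`. -/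
noncomputable def discreteModification (lo : LinearOrder X) (x : Realization G.vietorisRips) : X :=
  (x.coord.support.filter fun v => ∀ w, x.coord w ≤ x.coord v).min' (by
    obtain ⟨v, hv, h⟩ := G.exists_max_coordinate x
    exact ⟨v, Finset.mem_filter.2 ⟨hv, h⟩⟩)

end ReflexiveGraph

/-! ## Covers in which intersecting members are comparable -/

/-! The theorem reduces to comparing homotopy classes of maps on `(I^n, ∂I^n)` with values in
`|VR(X)|`, `R(X)` and `X`. The central point is that a continuous map `f` from a cube `P` to the
graph can be replaced by a continuous map `g` to `|VR(X)|`: cover `P` by finitely many small open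
sets with chosen centres, take a subordinate partition of unity, and let `g p` be the corresponding
convex combination of the vertices `f` takes at the centres. This makes sense only if the centres of
intersecting members have adjacent values.

Since `c_G` is not idempotent, an ordinary Lebesgue number does not give that. Continuity says that
`f q` is adjacent to `f p` for `q` in a ball around `p` whose radius depends on `p`; if two such
balls meet, their centres have values with a common neighbour, but adjacency is not transitive. What
is needed is that one of the two centres lies in the ball of the other, and this is
`HasComparableCovers`. It holds for cubes by induction on the dimension
(`HasComparableCovers.prod_unitInterval`).

`exists_realization_approx` carries out the approximation relative to a prescribed map `A` near the
boundary, by interpolating linearly between `A` and the partition of unity. Every vertex in the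
support of `g p` is adjacent to `f q` for all `q` near `p`, so `Θ ∘ g` is homotopic to `f` by a
single jump in time (`homotopic_of_tendsto`). Applied to a map on `I^n` this gives surjectivity of
`|VR(X)| → X` on classes; applied to a homotopy between `Θ ∘ a` and `Θ ∘ b` on `I^n × I` it gives
injectivity. Collars make the maps constant, or stationary, near the boundary, so that the
prescribed part matches.

For `R(X) → X`, injectivity is more direct: the section `v ↦ vertex v` turns continuous maps into
`X` into continuous maps into `R(X)`, and these can be pasted to the given ends because
neighbourhoods of vertices in `R(X)` are so coarse. Surjectivity is inherited from `|VR(X)|`, and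
the identity `|VR(X)| → R(X)` follows by two-out-of-three. -/

/-- For every assignment of radii `r` there is a finite open cover by sets `W`, each contained with
a uniform margin in the ball of radius `r c` around a centre `c`, such that whenever two members of
the cover intersect, one of the two centres lies in the ball around the other one. -/
def HasComparableCovers (P : Type*) [PseudoMetricSpace P] : Prop :=
  ∀ r : P → ℝ, (∀ p, 0 < r p) → ∃ δ > 0, ∃ F : Set (P × Set P), F.Finite ∧
    (∀ w ∈ F, IsOpen w.2) ∧ (∀ x, ∃ w ∈ F, x ∈ w.2) ∧
    (∀ w ∈ F, ∀ x ∈ w.2, dist x w.1 + δ ≤ r w.1) ∧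
    ∀ w ∈ F, ∀ w' ∈ F, (w.2 ∩ w'.2).Nonempty → dist w.1 w'.1 < max (r w.1) (r w'.1)

theorem hasComparableCovers_of_subsingleton (P : Type*) [PseudoMetricSpace P] [Subsingleton P]
    [Inhabited P] : HasComparableCovers P := by
  intro r hr
  refine ⟨r default, hr _, {(default, univ)}, finite_singleton _, ?_, ?_, ?_, ?_⟩
  · rintro w rfl
    exact isOpen_univ
  · exact fun x => ⟨_, rfl, mem_univ _⟩
  · rintro w rfl x -
    rw [Subsingleton.elim x default, dist_self, zero_add]
  · rintro w rfl w' rfl -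
    rw [dist_self]
    exact lt_max_of_lt_left (hr _)

theorem HasComparableCovers.of_isometryEquiv {P Q : Type*} [PseudoMetricSpace P]
    [PseudoMetricSpace Q] (e : P ≃ᵢ Q) (h : HasComparableCovers P) : HasComparableCovers Q := by
  intro r hr
  obtain ⟨δ, hδ, F, hF, hopen, hcov, hball, hcomp⟩ := h (fun p => r (e p)) fun p => hr _
  refine ⟨δ, hδ, (fun w => (e w.1, e '' w.2)) '' F, hF.image _, ?_, ?_, ?_, ?_⟩
  · rintro _ ⟨w, hw, rfl⟩
    exact e.toHomeomorph.isOpenMap _ (hopen w hw)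
  · intro x
    obtain ⟨w, hw, hx⟩ := hcov (e.symm x)
    exact ⟨_, ⟨w, hw, rfl⟩, e.symm x, hx, by simp⟩
  · rintro _ ⟨w, hw, rfl⟩ _ ⟨x, hx, rfl⟩
    simpa [e.dist_eq] using hball w hw x hx
  · rintro _ ⟨w, hw, rfl⟩ _ ⟨w', hw', rfl⟩ ⟨_, ⟨x, hx, rfl⟩, ⟨y, hy, hxy⟩⟩
    obtain rfl := e.injective hxy
    simpa [e.dist_eq] using hcomp w hw w' hw' ⟨_, hx, hy⟩

theorem exists_pos_le_of_pos (g : ℕ → ℝ) (hg : ∀ k, 0 < g k) (N : ℕ) :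
    ∃ δ > 0, ∀ k ≤ N, δ ≤ g k := by
  obtain ⟨k, -, hk⟩ := (Finset.range (N + 1)).exists_min_image g ⟨0, by simp⟩
  exact ⟨g k, hg k, fun j hj => hk j (by simp; omega)⟩

/-- A small piece of a slab near a slice: the products of the members of a family with a set `J`,
with centres moved to height `t`. -/
def thickenFamily {P Q : Type*} (F : Set (P × Set P)) (t : Q) (J : Set Q) :
    Set ((P × Q) × Set (P × Q)) :=
  (fun w => ((w.1, t), w.2 ×ˢ J)) '' F

/-- Cut the interval by finitely many heights into open slabs. Over each slab use one cover of `K`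
for the radii at a fixed nearby height; over a thin neighbourhood of each cut use a cover of `K`
with radii far smaller than the margins of the slab covers. Distinct slabs are disjoint, and so are
distinct cuts. If a slab piece meets a cut piece, the cut piece is so small that its centre falls
inside the ball of the slab piece. The margin `δ` in the definition is what makes this last
comparison, and hence the induction, possible. -/
theorem HasComparableCovers.prod_unitInterval {K : Type*} [PseudoMetricSpace K]
    (h : HasComparableCovers K) : HasComparableCovers (K × unitInterval) := by
  classical
  intro r hr
  choose δ hδ F hF hopen hcov hball hcomp using fun t : unitInterval =>
    h (fun k => r (k, t)) fun k => hr _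
  -- The cover at height `t` has margin `δ t`. Half of it pays for moving the height within a slab,
  -- half is kept for the comparison with the cut pieces.
  obtain ⟨lam, hlam, hleb⟩ := lebesgue_number_lemma_of_metric (ι := unitInterval)
    (c := fun t => Metric.ball t (δ t / 2)) (isCompact_univ (X := unitInterval))
    (fun t => Metric.isOpen_ball)
    (fun t _ => mem_iUnion.2 ⟨t, Metric.mem_ball_self (half_pos (hδ t))⟩)
  obtain ⟨N, hN⟩ := exists_nat_one_div_lt hlam
  set M : ℝ := (N : ℝ) + 1 with hM
  have hMpos : 0 < M := by positivity
  let s : ℕ → unitInterval := fun k => projIcc 0 1 zero_le_one ((k : ℝ) / M)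
  have hs : ∀ k ≤ N + 1, (s k : ℝ) = k / M := by
    intro k hk
    have hk' : (k : ℝ) ≤ M := by rw [hM]; exact_mod_cast hk
    have h1 : (k : ℝ) / M ≤ 1 := (div_le_one hMpos).2 hk'
    simp only [s, coe_projIcc]
    rw [min_eq_right h1, max_eq_right (by positivity)]
  choose t ht using fun k : ℕ => hleb (s k) (mem_univ _)
  obtain ⟨Δ, hΔ, hΔle⟩ := exists_pos_le_of_pos (fun k => δ (t k) / 2) (fun k => half_pos (hδ _)) N
  -- Truncating the radii at `Δ`, at most half of every slab margin, forces the cut pieces to be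
  -- small compared with the slab pieces.
  choose δ' hδ' F' hF' hopen' hcov' hball' hcomp' using fun k : ℕ =>
    h (fun x => min (r (x, s k)) Δ) fun x => lt_min (hr _) hΔ
  obtain ⟨η₀, hη₀, hη₀le⟩ := exists_pos_le_of_pos (fun k => δ' k / 2) (fun k => half_pos (hδ' _))
    (N + 1)
  -- `η` is the half-thickness of a cut: below half the cut margins, below `Δ` for the mixed
  -- comparison, and at most half the spacing `1 / M` so that distinct cuts stay disjoint.
  obtain ⟨η, hη, hη1, hη2, hη3⟩ : ∃ η > 0, η ≤ η₀ ∧ η ≤ Δ ∧ 2 * η ≤ 1 / M := by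
    refine ⟨min (min η₀ Δ) (1 / M / 2), by positivity, ?_, ?_, ?_⟩
    · exact (min_le_left _ _).trans (min_le_left _ _)
    · exact (min_le_left _ _).trans (min_le_right _ _)
    · linarith [min_le_right (min η₀ Δ) (1 / M / 2)]
  let slab : ℕ → Set unitInterval := fun k => {x | (k : ℝ) / M < x ∧ (x : ℝ) < (k + 1) / M}
  have hslab_ball : ∀ k ≤ N, ∀ x ∈ slab k, dist x (t k) < δ (t k) / 2 := by
    intro k hk x hx
    have : x ∈ Metric.ball (s k) lam := by
      rw [Metric.mem_ball, Subtype.dist_eq, Real.dist_eq, hs k (by omega), abs_lt]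
      have h1 := hx.1
      have h2 := hx.2
      rw [add_div] at h2
      constructor <;> linarith
    exact ht k this
  have hslab_open : ∀ k, IsOpen (slab k) := fun k =>
    (isOpen_lt continuous_const continuous_subtype_val).inter
      (isOpen_lt continuous_subtype_val continuous_const)
  have hslice_dist : ∀ k ≤ N + 1, ∀ l ≤ N + 1, dist (s k) (s l) < 1 / M → k = l := by
    intro k hk l hl hkl
    rw [Subtype.dist_eq, Real.dist_eq, hs k hk, hs l hl, ← sub_div, abs_div, abs_of_pos hMpos,
      div_lt_div_iff_of_pos_right hMpos] at hkl
    have : |(k : ℤ) - l| < 1 := by exact_mod_cast hkl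
    rw [Int.abs_lt_one_iff] at this
    omega
  have hslab_disj : ∀ k l x, x ∈ slab k → x ∈ slab l → k = l := by
    intro k l x hk hl
    have h1 := hk.1.trans hl.2
    have h2 := hl.1.trans hk.2
    rw [div_lt_div_iff_of_pos_right hMpos] at h1 h2
    have h1' : k < l + 1 := by exact_mod_cast h1
    have h2' : l < k + 1 := by exact_mod_cast h2
    omega
  -- The slab piece always wins. In `K` its margin `δ (t k)` exceeds the size `Δ` of the cut piece;
  -- in height the two errors are each at most `δ (t k) / 2`, and `δ (t k) ≤ r (w.1, t k)`.
  have mixed : ∀ k ≤ N, ∀ l ≤ N + 1, ∀ w ∈ F (t k), ∀ w' ∈ F' l, ∀ x ∈ w.2, x ∈ w'.2 →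
      ∀ y ∈ slab k, y ∈ Metric.ball (s l) η → dist (w.1, t k) (w'.1, s l) < r (w.1, t k) := by
    intro k hk l hl w hw w' hw' x hx hx' y hy hy'
    have e1 := hball _ w hw x hx
    have e2 := hball' _ w' hw' x hx'
    have e3 : min (r (w'.1, s l)) Δ ≤ Δ := min_le_right _ _
    have e4 := hΔle k hk
    have e5 := hδ' l
    have e6 := hslab_ball k hk y hy
    rw [Metric.mem_ball] at hy'
    have e7 : 0 ≤ dist x w.1 := dist_nonneg
    rw [Prod.dist_eq]
    refine max_lt ?_ ?_
    · calc dist w.1 w'.1 ≤ dist x w.1 + dist x w'.1 := dist_triangle_left _ _ _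
        _ < r (w.1, t k) := by linarith
    · calc dist (t k) (s l) ≤ dist y (t k) + dist y (s l) := dist_triangle_left _ _ _
        _ < r (w.1, t k) := by linarith
  refine ⟨min Δ η, lt_min hΔ hη,
    (⋃ k ∈ Finset.range (N + 1), thickenFamily (F (t k)) (t k) (slab k)) ∪
      (⋃ k ∈ Finset.range (N + 2), thickenFamily (F' k) (s k) (Metric.ball (s k) η)),
    ?_, ?_, ?_, ?_, ?_⟩
  · exact ((Finset.finite_toSet _).biUnion fun k _ => (hF _).image _).union
      ((Finset.finite_toSet _).biUnion fun k _ => (hF' _).image _)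
  · rintro _ (hm | hm) <;> obtain ⟨k, hk, w, hw, rfl⟩ := mem_iUnion₂.1 hm
    · exact (hopen _ w hw).prod (hslab_open k)
    · exact (hopen' _ w hw).prod Metric.isOpen_ball
  · rintro ⟨x, y⟩
    have hy0 : 0 ≤ (y : ℝ) * M := mul_nonneg y.2.1 hMpos.le
    set k := ⌊(y : ℝ) * M⌋₊ with hk
    have hk1 : (k : ℝ) ≤ y * M := Nat.floor_le hy0
    have hk2 : (y : ℝ) * M < k + 1 := Nat.lt_floor_add_one _
    have hkN : k ≤ N + 1 := by
      have : (k : ℝ) ≤ N + 1 := hk1.trans (by nlinarith [y.2.2])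
      exact_mod_cast this
    -- The open slabs miss exactly the cut heights `k / M`, including the end `y = 1` with `k = N +
    -- 1`; these are covered by the thickened cuts.
    rcases hk1.eq_or_lt with heq | hlt
    · obtain ⟨w, hw, hx⟩ := hcov' k x
      refine ⟨_, Or.inr (mem_iUnion₂.2 ⟨k, by simp; omega, w, hw, rfl⟩), hx, ?_⟩
      have : y = s k := by
        refine Subtype.ext ?_
        rw [hs k hkN, heq]
        field_simp
      rw [this]
      exact Metric.mem_ball_self hη
    · obtain ⟨w, hw, hx⟩ := hcov (t k) x
      have hkN' : k < N + 1 := by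
        have : (k : ℝ) < N + 1 := hlt.trans_le (by nlinarith [y.2.2])
        exact_mod_cast this
      exact ⟨_, Or.inl (mem_iUnion₂.2 ⟨k, by simp; omega, w, hw, rfl⟩), hx,
        (div_lt_iff₀ hMpos).2 hlt, (lt_div_iff₀ hMpos).2 hk2⟩
  · rintro _ (hm | hm) <;> obtain ⟨k, hk, w, hw, rfl⟩ := mem_iUnion₂.1 hm
    · rintro ⟨x, y⟩ ⟨hx, hy⟩
      have hk' : k ≤ N := by simpa [Nat.lt_succ_iff] using hk
      have e1 := hball _ w hw x hx
      have e2 := hslab_ball k hk' y hy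
      have e3 := hΔle k hk'
      have e4 := hδ (t k)
      have e5 : 0 ≤ dist x w.1 := dist_nonneg
      rw [Prod.dist_eq]
      have : max (dist x w.1) (dist y (t k)) + Δ ≤ r (w.1, t k) := by
        rw [max_add]; refine max_le ?_ ?_ <;> linarith
      exact (add_le_add_right (min_le_left _ _) _).trans this
    · rintro ⟨x, y⟩ ⟨hx, hy⟩
      have hk' : k ≤ N + 1 := by simp at hk; omega
      have e1 := hball' _ w hw x hx
      rw [Metric.mem_ball] at hy
      have e3 := hη₀le k hk'
      have e5 : 0 ≤ dist x w.1 := dist_nonneg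
      have e6 : min (r (w.1, s k)) Δ ≤ r (w.1, s k) := min_le_left _ _
      have e7 := hδ' k
      have : max (dist x w.1) (dist y (s k)) + η ≤ r (w.1, s k) := by
        rw [max_add]; refine max_le ?_ ?_ <;> linarith
      exact (add_le_add_right (min_le_right _ _) _).trans this
  · rintro _ (hm | hm) _ (hm' | hm') <;> obtain ⟨k, hk, w, hw, rfl⟩ := mem_iUnion₂.1 hm <;>
      obtain ⟨l, hl, w', hw', rfl⟩ := mem_iUnion₂.1 hm' <;>
      rintro ⟨⟨x, y⟩, ⟨hx, hy⟩, ⟨hx', hy'⟩⟩ <;> simp only [Finset.mem_range] at hk hl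
    · obtain rfl := hslab_disj k l y hy hy'
      simp only [Prod.dist_eq, dist_self, max_eq_left dist_nonneg]
      exact hcomp _ w hw w' hw' ⟨x, hx, hx'⟩
    · exact lt_max_of_lt_left (mixed k (by omega) l (by omega) w hw w' hw' x hx hx' y hy hy')
    · rw [dist_comm]
      exact lt_max_of_lt_right (mixed l (by omega) k (by omega) w' hw' w hw x hx' hx y hy' hy)
    · simp only [Metric.mem_ball] at hy hy'
      obtain rfl := hslice_dist k (by omega) l (by omega)
        ((dist_triangle_left _ _ y).trans_lt (by linarith))
      simp only [Prod.dist_eq, dist_self, max_eq_left dist_nonneg]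
      refine (hcomp' _ w hw w' hw' ⟨x, hx, hx'⟩).trans_le ?_
      exact max_le_max (min_le_left _ _) (min_le_left _ _)

/-- The isometry `I^n × I ≃ I^(n+1)`. -/
def cubeSnocIsometry (n : ℕ) :
    (Fin n → unitInterval) × unitInterval ≃ᵢ (Fin (n + 1) → unitInterval) where
  toFun p := Fin.cons p.2 p.1
  invFun t := (Fin.tail t, t 0)
  left_inv p := by simp
  right_inv t := by simp
  isometry_toFun := Isometry.of_dist_eq fun p q => by
    have := Fin.dist_insertNth_insertNth (α := fun _ => unitInterval) (0 : Fin (n + 1))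
      p.2 q.2 p.1 q.1
    simp only [Fin.insertNth_zero'] at this
    rw [Prod.dist_eq, max_comm]
    exact this

theorem hasComparableCovers_cube (n : ℕ) : HasComparableCovers (Fin n → unitInterval) := by
  induction n with
  | zero => exact hasComparableCovers_of_subsingleton _
  | succ n ih => exact ih.prod_unitInterval.of_isometryEquiv (cubeSnocIsometry n)

/-! ## The topology of the geometric realization -/

namespace Realization

variable {V : Type u} {K : AbstractSimplicialComplex V}

theorem coord_injective : Function.Injective (Realization.coord (K := K)) := by
  rintro ⟨a, _, _, _⟩ ⟨b, _, _, _⟩ h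
  obtain rfl : a = b := h
  rfl

theorem continuous_coord (v : V) : Continuous fun x : Realization K => x.coord v := by
  refine continuous_iSup_dom.2 fun σ => continuous_coinduced_dom.2 ?_
  let _ := Realization.faceTopology K σ.1
  exact (continuous_apply v).comp continuous_induced_dom

/-- Each coordinate is continuous, and only finitely many must stay nonzero: carriers can only grow
under small perturbation. -/
theorem eventually_support_subset (x : Realization K) :
    ∀ᶠ y in 𝓝 x, x.coord.support ⊆ y.coord.support := by
  have : ∀ᶠ y in 𝓝 x, ∀ v ∈ x.coord.support, y.coord v ≠ 0 := by
    rw [Filter.eventually_all_finset]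
    intro v hv
    exact (continuous_coord v).continuousAt.eventually_ne (Finsupp.mem_support_iff.1 hv)
  filter_upwards [this] with y hy v hv
  exact Finsupp.mem_support_iff.2 (hy v hv)

theorem isClosed_iff {C : Set (Realization K)} :
    IsClosed C ↔ ∀ σ ∈ K.faces, ∃ D : Set (V → ℝ), IsClosed D ∧
      ∀ x : Realization K, x.coord.support ⊆ σ → ((fun v => x.coord v) ∈ D ↔ x ∈ C) := by
  rw [isClosed_iSup_iff]
  simp only [isClosed_coinduced, isClosed_induced_iff]
  constructor
  · intro h σ hσ
    obtain ⟨D, hD, hDC⟩ := h ⟨σ, hσ⟩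
    exact ⟨D, hD, fun x hx => (Set.ext_iff.1 hDC ⟨x, hx⟩)⟩
  · rintro h ⟨σ, hσ⟩
    obtain ⟨D, hD, hDC⟩ := h σ hσ
    exact ⟨D, hD, Set.ext fun x => hDC x.1 x.2⟩

/-- A map into the realization whose values are supported on a fixed finite set of vertices is
continuous as soon as its barycentric coordinates are. -/
theorem continuous_of_coord {P : Type*} [TopologicalSpace P] {g : P → Realization K}
    {S : Finset V} (hS : ∀ p, (g p).coord.support ⊆ S)
    (hc : ∀ v, Continuous fun p => (g p).coord v) : Continuous g := by
  classical
  rw [continuous_iff_isClosed]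
  intro C hC
  -- `S` need not be a simplex, so the preimage is split according to the finitely many faces
  -- contained in `S`; on each of them the coherent topology is the Euclidean one.
  have hpre : g ⁻¹' C = ⋃ σ ∈ S.powerset.filter (· ∈ K.faces),
      {p | (g p).coord.support ⊆ σ ∧ g p ∈ C} := by
    ext p
    simp only [mem_preimage, mem_iUnion, Finset.mem_filter, Finset.mem_powerset, mem_ofPred_eq,
      exists_prop]
    exact ⟨fun h => ⟨_, ⟨hS p, (g p).support_mem⟩, subset_rfl, h⟩, fun ⟨_, _, _, h⟩ => h⟩
  rw [hpre]
  refine isClosed_biUnion_finset fun σ hσ => ?_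
  obtain ⟨D, hD, hDC⟩ := isClosed_iff.1 hC σ (Finset.mem_filter.1 hσ).2
  have : {p | (g p).coord.support ⊆ σ ∧ g p ∈ C} =
      (⋂ v ∈ S \ σ, {p | (g p).coord v = 0}) ∩ (fun p v => (g p).coord v) ⁻¹' D := by
    ext p
    simp only [mem_ofPred_eq, mem_inter_iff, mem_iInter, Finset.mem_sdiff, mem_preimage]
    have hiff : (g p).coord.support ⊆ σ ↔ ∀ v, v ∈ S ∧ v ∉ σ → (g p).coord v = 0 := by
      constructor
      · intro h v hv
        by_contra hne
        exact hv.2 (h (Finsupp.mem_support_iff.2 hne))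
      · intro h v hv
        by_contra hne
        exact Finsupp.mem_support_iff.1 hv (h v ⟨hS p hv, hne⟩)
    rw [← hiff]
    exact and_congr_right fun h => (hDC _ h).symm
  rw [this]
  exact (isClosed_biInter fun v _ => isClosed_eq (hc v) continuous_const).inter
    (hD.preimage (continuous_pi hc))

/-- A simplex has finitely many faces, so such a set meets each closed simplex in finitely many
points and is closed in the coherent topology. -/
theorem isClosed_of_injOn_support {B : Set (Realization K)}
    (hB : InjOn (fun x : Realization K => x.coord.support) B) : IsClosed B := by
  refine isClosed_iff.2 fun σ _ => ?_
  have hfin : (B ∩ {x | x.coord.support ⊆ σ}).Finite := by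
    refine Set.Finite.of_finite_image (f := fun x : Realization K => x.coord.support) ?_
      (hB.mono inter_subset_left)
    refine (Finset.finite_toSet σ.powerset).subset ?_
    rintro _ ⟨x, hx, rfl⟩
    simpa using hx.2
  refine ⟨(fun (x : Realization K) v => x.coord v) '' (B ∩ {x | x.coord.support ⊆ σ}),
    (hfin.image _).isClosed, fun x hx => ?_⟩
  constructor
  · rintro ⟨y, hy, hyx⟩
    obtain rfl : y = x := coord_injective (DFunLike.coe_injective hyx)
    exact hy.1
  · exact fun h => ⟨x, ⟨h, hx⟩, rfl⟩

/-- A compact subset of the realization is contained in a finite subcomplex. -/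
theorem exists_finset_support_subset {T : Set (Realization K)} (hT : IsCompact T) :
    ∃ S : Finset V, ∀ x ∈ T, x.coord.support ⊆ S := by
  classical
  -- Pick one point of `T` for each support that occurs. Every subset of this selection is closed,
  -- so it is discrete as well as compact, hence finite.
  obtain ⟨B, hBT, hB⟩ := (surjOn_image (fun x : Realization K => x.coord.support) T).exists_bijOn_subset
  have hcl : ∀ C ⊆ B, IsClosed C := fun C hC => isClosed_of_injOn_support (hB.injOn.mono hC)
  have hcomp : IsCompact B := hT.of_isClosed_subset (hcl B subset_rfl) hBT
  have hfin : B.Finite := by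
    refine hcomp.finite ?_
    rw [isDiscrete_iff_discreteTopology, discreteTopology_iff_forall_isClosed]
    intro C
    have := (hcl (Subtype.val '' C) (by rintro _ ⟨x, -, rfl⟩; exact x.2)).preimage
      (continuous_subtype_val (p := (· ∈ B)))
    rwa [preimage_image_eq _ Subtype.val_injective] at this
  refine ⟨hfin.toFinset.biUnion fun x => x.coord.support, fun x hx => ?_⟩
  obtain ⟨y, hy, hyx⟩ := hB.surjOn (mem_image_of_mem _ hx)
  rw [← show y.coord.support = x.coord.support from hyx]
  exact Finset.subset_biUnion_of_mem (fun x : Realization K => x.coord.support)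
    (hfin.mem_toFinset.2 hy)

theorem support_vertex (v : V) : (vertex K v).coord.support = {v} :=
  Finsupp.support_single v one_ne_zero

end Realization

/-! ## Approximation of maps into a graph by maps into the realization -/

namespace ReflexiveGraph

variable {X : Type u} (G : ReflexiveGraph X)

/-- Symmetry of the adjacency relation turns the closure into a neighbourhood description: every
vertex has a smallest neighbourhood, its set of adjacent vertices. -/
theorem closure_nhds (x : X) : G.closure.nhds x = 𝓟 {y | G.Adj x y} := by
  ext U
  rw [CechClosure.mem_nhds, mem_principal]
  simp only [closure, mem_iUnion, mem_compl_iff, mem_ofPred_eq, exists_prop, not_exists, not_and]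
  constructor
  · intro h y hy
    by_contra hU
    exact h y hU (G.symm _ _ hy)
  · intro h y hU hy
    exact hU (h (G.symm _ _ hy))

theorem isContinuous_closure_iff {P : Type*} [TopologicalSpace P] {f : P → X} :
    CechClosure.IsContinuous (CechClosure.ofTopology P) G.closure f ↔
      ∀ p, ∀ᶠ q in 𝓝 p, G.Adj (f p) (f q) := by
  simp only [CechClosure.isContinuous_ofTopology_iff, closure_nhds, tendsto_principal,
    mem_ofPred_eq]

theorem adj_of_mem_support {G : ReflexiveGraph X} (x : Realization G.vietorisRips) {v w : X}
    (hv : v ∈ x.coord.support) (hw : w ∈ x.coord.support) : G.Adj v w :=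
  x.support_mem.2 v hv w hw

/-- A finitely supported family of weights with total mass one whose support is a clique. -/
noncomputable def realizationMk (a : X →₀ ℝ) (h0 : ∀ v, 0 ≤ a v)
    (h1 : Finsupp.linearCombination ℝ (fun _ : X => (1 : ℝ)) a = 1)
    (hadj : ∀ v ∈ a.support, ∀ w ∈ a.support, G.Adj v w) : Realization G.vietorisRips where
  coord := a
  coord_nonneg := h0
  sum_coord := by simpa [Finsupp.linearCombination_apply, Finsupp.sum] using h1
  support_mem := by
    refine ⟨?_, hadj⟩
    rw [Finsupp.support_nonempty_iff]
    rintro rfl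
    simp at h1

/-- A continuous map `f` from a space with comparable covers to a graph can be approximated by a
continuous map to the realization, prescribed where `ν = 0`, provided that near this set `f` selects
a vertex of the carrier of the prescribed map. -/
theorem exists_realization_approx {P : Type*} [MetricSpace P] [CompactSpace P]
    (hP : HasComparableCovers P) {f : P → X}
    (hf : CechClosure.IsContinuous (CechClosure.ofTopology P) G.closure f) {ν : P → ℝ}
    (hν : Continuous ν) (hν0 : ∀ p, 0 ≤ ν p) {A : P → Realization G.vietorisRips}
    (hA : ∀ p, ν p < 2 → ContinuousAt A p) (hfA : ∀ p, ν p < 2 → f p ∈ (A p).coord.support) :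
    ∃ g : P → Realization G.vietorisRips, Continuous g ∧ (∀ p, ν p = 0 → g p = A p) ∧
      ∀ p, ∀ w ∈ (g p).coord.support, ∀ᶠ q in 𝓝 p, G.Adj w (f q) := by
  classical
  rw [isContinuous_closure_iff] at hf
  -- Within distance `ε` the function `ν` varies by less than `1`, so the centres of pieces
  -- containing a point with `ν < 1` still satisfy `ν < 2`, where `A` is controlled.
  obtain ⟨ε, hε, hνε⟩ := Metric.uniformContinuous_iff.1
    (CompactSpace.uniformContinuous_of_continuous hν) 1 one_pos
  have hr : ∀ p, ∃ r > 0, r ≤ ε ∧ ∀ q, dist q p < r →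
      G.Adj (f p) (f q) ∧ (ν p < 2 → (A p).coord.support ⊆ (A q).coord.support) := by
    intro p
    have : ∀ᶠ q in 𝓝 p, G.Adj (f p) (f q) ∧
        (ν p < 2 → (A p).coord.support ⊆ (A q).coord.support) := by
      refine (hf p).and ?_
      by_cases hp : ν p < 2
      · filter_upwards [(hA p hp).eventually (Realization.eventually_support_subset (A p))]
          with q hq _ using hq
      · exact Eventually.of_forall fun q h => absurd h hp
    obtain ⟨r, hr, hball⟩ := Metric.eventually_nhds_iff.1 this
    exact ⟨min r ε, lt_min hr hε, min_le_right _ _,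
      fun q hq => hball (hq.trans_le (min_le_left _ _))⟩
  choose r hr0 hrε hrball using hr
  obtain ⟨δ, hδ, F, hF, hopen, hcov, hball, hcomp⟩ := hP r hr0
  have hcl : ∀ w ∈ F, ∀ x ∈ w.2, dist x w.1 < r w.1 := fun w hw x hx => by
    linarith [hball w hw x hx]
  have : Fintype F := hF.fintype
  obtain ⟨φ, hφ⟩ := PartitionOfUnity.exists_isSubordinate (ι := F) (s := univ) isClosed_univ
    (fun w => w.1.2) (fun w => hopen w.1 w.2) (fun x _ => by
      obtain ⟨w, hw, hx⟩ := hcov x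
      exact mem_iUnion.2 ⟨⟨w, hw⟩, hx⟩)
  have hφmem : ∀ i p, φ i p ≠ 0 → p ∈ i.1.2 := fun i p h => hφ i (subset_tsupport _ h)
  have hφsum : ∀ p, ∑ i, φ i p = 1 := fun p => by
    rw [← finsum_eq_sum_of_fintype]
    exact φ.sum_eq_one (mem_univ p)
  set μ : P → ℝ := fun p => min 1 (ν p) with hμ
  have hμc : Continuous μ := continuous_const.min hν
  have hμ0 : ∀ p, 0 ≤ μ p := fun p => le_min zero_le_one (hν0 p)
  have hμ1 : ∀ p, μ p ≤ 1 := fun p => min_le_left _ _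
  let D : P → X →₀ ℝ := fun p => ∑ i : F, Finsupp.single (f i.1.1) (φ i p)
  -- Linear interpolation: the prescribed map where `ν = 0`, the partition-of-unity map `D` alone
  -- where `ν ≥ 1`.
  let a : P → X →₀ ℝ := fun p => (1 - μ p) • (A p).coord + μ p • D p
  have hDapp : ∀ p v, D p v = ∑ i : F, if f i.1.1 = v then φ i p else 0 := fun p v => by
    simp only [D, Finsupp.coe_finsetSum, Finset.sum_apply, Finsupp.single_apply]
  have haapp : ∀ p v, a p v = (1 - μ p) * (A p).coord v + μ p * D p v := fun p v => rfl
  have hsupp : ∀ p, ∀ v ∈ (a p).support,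
      (ν p < 1 ∧ v ∈ (A p).coord.support) ∨ ∃ w ∈ F, p ∈ w.2 ∧ f w.1 = v := by
    intro p v hv
    rw [Finsupp.mem_support_iff, haapp] at hv
    by_cases hD : D p v = 0
    · left
      rw [hD, mul_zero, add_zero] at hv
      refine ⟨?_, Finsupp.mem_support_iff.2 (right_ne_zero_of_mul hv)⟩
      by_contra h
      refine left_ne_zero_of_mul hv ?_
      rw [hμ]
      simp only
      rw [min_eq_left (not_lt.1 h), sub_self]
    · right
      rw [hDapp] at hD
      obtain ⟨i, -, hi⟩ := Finset.exists_ne_zero_of_sum_ne_zero hD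
      split_ifs at hi with hiv
      · exact ⟨i.1, i.2, hφmem i p hi, hiv⟩
      · exact absurd rfl hi
  -- In the transition zone the new vertices add nothing to the carrier: an active centre `w` has `f
  -- w` in the support of `A w`, which lies in the support of `A p` by the choice of radii.
  have hcarrier : ∀ p, ν p < 1 → ∀ v ∈ (a p).support, v ∈ (A p).coord.support := by
    intro p hp v hv
    rcases hsupp p v hv with h | ⟨w, hw, hpw, rfl⟩
    · exact h.2
    · have hd := hcl w hw p hpw
      have hνw : ν w.1 < 2 := by
        have := hνε (hd.trans_le (hrε _))
        rw [Real.dist_eq, abs_lt] at this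
        linarith [this.1]
      exact (hrball _ p hd).2 hνw (hfA _ hνw)
  have hadj : ∀ p, ∀ v ∈ (a p).support, ∀ w ∈ (a p).support, G.Adj v w := by
    intro p v hv w hw
    by_cases hp : ν p < 1
    · exact adj_of_mem_support (A p) (hcarrier p hp v hv) (hcarrier p hp w hw)
    · obtain ⟨y, hy, hpy, rfl⟩ := (hsupp p v hv).resolve_left fun h => hp h.1
      obtain ⟨z, hz, hpz, rfl⟩ := (hsupp p w hw).resolve_left fun h => hp h.1
      -- Comparability of the cover enters here: one centre lies in the ball of the other, so their
      -- values are adjacent.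
      rcases lt_max_iff.1 (hcomp y hy z hz ⟨p, hpy, hpz⟩) with h | h
      · rw [dist_comm] at h
        exact (hrball _ _ h).1
      · exact G.symm _ _ (hrball _ _ h).1
  have hD0 : ∀ p v, 0 ≤ D p v := fun p v => by
    rw [hDapp]
    refine Finset.sum_nonneg fun i _ => ?_
    split_ifs
    · exact φ.nonneg i p
    · exact le_rfl
  have ha0 : ∀ p v, 0 ≤ a p v := fun p v => by
    rw [haapp]
    exact add_nonneg (mul_nonneg (sub_nonneg.2 (hμ1 p)) ((A p).coord_nonneg v))
      (mul_nonneg (hμ0 p) (hD0 p v))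
  have hAsum : ∀ p, Finsupp.linearCombination ℝ (fun _ : X => (1 : ℝ)) (A p).coord = 1 := fun p => by
    simpa [Finsupp.linearCombination_apply, Finsupp.sum] using (A p).sum_coord
  have ha1 : ∀ p, Finsupp.linearCombination ℝ (fun _ : X => (1 : ℝ)) (a p) = 1 := fun p => by
    simp only [a, D, map_add, map_smul, map_sum, hAsum, Finsupp.linearCombination_single, smul_eq_mul,
      mul_one, hφsum]
    ring
  have hDc : ∀ v, Continuous fun p => D p v := fun v => by
    simp only [hDapp]
    refine continuous_finsetSum _ fun i _ => ?_
    split_ifs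
    · exact (φ i).continuous
    · exact continuous_const
  have hac : ∀ v, Continuous fun p => a p v := fun v => by
    simp only [haapp]
    refine Continuous.add ?_ (hμc.mul (hDc v))
    -- `A` is continuous only where `ν < 2`; elsewhere the factor `1 - μ` vanishes on a
    -- neighbourhood.
    refine continuous_iff_continuousAt.2 fun p => ?_
    by_cases hp : ν p < 2
    · exact (continuous_const.sub hμc).continuousAt.mul
        ((Realization.continuous_coord v).continuousAt.comp (hA p hp))
    · have : ∀ᶠ q in 𝓝 p, (0 : ℝ) = (1 - μ q) * (A q).coord v := by
        filter_upwards [hν.continuousAt.eventually (lt_mem_nhds (a := 1) (by linarith))] with q hq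
        simp only [hμ]
        rw [min_eq_left hq.le, sub_self, zero_mul]
      exact (continuousAt_const (y := (0 : ℝ))).congr this
  have hT : IsCompact (A '' {p | ν p ≤ 1}) :=
    (isClosed_le hν continuous_const).isCompact.image_of_continuousOn fun p hp =>
      (hA p (lt_of_le_of_lt hp one_lt_two)).continuousWithinAt
  obtain ⟨S, hS⟩ := Realization.exists_finset_support_subset hT
  refine ⟨fun p => G.realizationMk (a p) (ha0 p) (ha1 p) (hadj p),
    Realization.continuous_of_coord (S := S ∪ hF.toFinset.image fun w => f w.1) ?_ hac, ?_, ?_⟩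
  · intro p v hv
    rcases hsupp p v hv with h | ⟨w, hw, -, rfl⟩
    · exact Finset.mem_union_left _ (hS _ (mem_image_of_mem A h.1.le) h.2)
    · exact Finset.mem_union_right _ (Finset.mem_image_of_mem (fun w : P × Set P => f w.1)
        (hF.mem_toFinset.2 hw))
  · intro p hp
    refine Realization.coord_injective (Finsupp.ext fun v => ?_)
    have : μ p = 0 := by simp [hμ, hp]
    change a p v = _
    rw [haapp, this]
    ring
  · intro p w hw
    rcases hsupp p w hw with h | ⟨y, hy, hpy, rfl⟩
    · have hp2 : ν p < 2 := h.1.trans one_lt_two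
      filter_upwards [(hA p hp2).eventually (Realization.eventually_support_subset (A p)),
        hν.continuousAt.eventually (gt_mem_nhds hp2)] with q hq hq2
      exact adj_of_mem_support (A q) (hq h.2) (hfA q hq2)
    · filter_upwards [(hopen y hy).mem_nhds hpy] with q hq
      exact (hrball _ q (hcl y hy q hq)).1

end ReflexiveGraph

/-! ## The closure space `R(X)` and the map `Θ` -/

namespace ReflexiveGraph

variable {X : Type u} (G : ReflexiveGraph X)

theorem discreteModification_mem_support (lo : LinearOrder X) (x : Realization G.vietorisRips) :
    G.discreteModification lo x ∈ x.coord.support := by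
  classical
  exact Finset.filter_subset _ _ (Finset.min'_mem _ _)

/-- At a vertex this holds on its closed star; at any other point carriers grow, so both supports
lie in one clique. It is the common ground of the two kinds of neighbourhoods and makes `Θ`
continuous for any choice of a vertex in the carrier. -/
theorem eventually_rNhds_adj (x : Realization G.vietorisRips) :
    ∀ᶠ y in G.rNhds x, ∀ v ∈ x.coord.support, ∀ w ∈ y.coord.support, G.Adj v w := by
  unfold rNhds
  split_ifs with h
  · rw [eventually_principal]
    intro y hy v hv w hw
    obtain ⟨σ, ⟨hσ, u, hu, rfl⟩, hyσ⟩ := mem_iUnion₂.1 hy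
    rw [Realization.support_vertex, Finset.mem_singleton] at hv
    subst hv
    exact hσ.2 v hu w (hyσ hw)
  · filter_upwards [Realization.eventually_support_subset x] with y hy v hv w hw
    exact adj_of_mem_support y (hy hv) hw

/-- A point lies in the closed star of `v` as soon as `v` is adjacent to its whole support, since
adjoining `v` then gives a clique. -/
theorem tendsto_rNhds_vertex {ι : Type*} {l : Filter ι} {g : ι → Realization G.vietorisRips} {v : X}
    (h : ∀ᶠ i in l, ∀ w ∈ (g i).coord.support, G.Adj v w) :
    Tendsto g l (G.rNhds (Realization.vertex G.vietorisRips v)) := by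
  classical
  unfold rNhds
  rw [if_pos ⟨v, rfl⟩, tendsto_principal]
  filter_upwards [h] with i hi
  refine mem_iUnion₂.2 ⟨insert v (g i).coord.support, ⟨⟨Finset.insert_nonempty _ _, ?_⟩, v,
    Finset.mem_insert_self _ _, rfl⟩, Finset.subset_insert _ _⟩
  intro a ha b hb
  rcases Finset.mem_insert.1 ha with rfl | ha' <;> rcases Finset.mem_insert.1 hb with rfl | hb'
  · exact G.refl _
  · exact hi b hb'
  · exact G.symm _ _ (hi a ha')
  · exact adj_of_mem_support (g i) ha' hb'

theorem isContinuous_discreteModification (lo : LinearOrder X) :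
    CechClosure.IsContinuous G.rClosure G.closure (G.discreteModification lo) := by
  rw [CechClosure.isContinuous_iff]
  intro x
  rw [rClosure, CechClosure.nhds_ofNhds, closure_nhds, tendsto_principal]
  filter_upwards [G.eventually_rNhds_adj x] with y hy
  exact hy _ (G.discreteModification_mem_support lo x) _ (G.discreteModification_mem_support lo y)

theorem isContinuous_id : CechClosure.IsContinuous G.vrClosure G.rClosure id := by
  rw [CechClosure.isContinuous_iff]
  intro x
  rw [rClosure, CechClosure.nhds_ofNhds, vrClosure, CechClosure.nhds_ofTopology]
  by_cases h : ∃ v, x = Realization.vertex G.vietorisRips v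
  · obtain ⟨v, rfl⟩ := h
    refine G.tendsto_rNhds_vertex ?_
    filter_upwards [Realization.eventually_support_subset
      (Realization.vertex G.vietorisRips v)] with y hy w hw
    exact adj_of_mem_support y (hy (by simp [Realization.support_vertex])) hw
  · simp only [id, rNhds, if_neg h]
    exact tendsto_id

theorem vrClosure_nhds (x : Realization G.vietorisRips) : G.vrClosure.nhds x = 𝓝 x :=
  CechClosure.nhds_ofTopology x

theorem rClosure_nhds (x : Realization G.vietorisRips) : G.rClosure.nhds x = G.rNhds x :=
  CechClosure.nhds_ofNhds _ _ x

/-- The section `v ↦ vertex v` of `Θ` lifts maps into the graph to `R(X)`. It is the reason for the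
coarse neighbourhoods at vertices, and has no analogue for the topology of `|VR(X)|`. -/
theorem isContinuous_vertex_comp {P : Type*} [TopologicalSpace P] {f : P → X}
    (hf : CechClosure.IsContinuous (CechClosure.ofTopology P) G.closure f) :
    CechClosure.IsContinuous (CechClosure.ofTopology P) G.rClosure
      (fun p => Realization.vertex G.vietorisRips (f p)) := by
  rw [isContinuous_closure_iff] at hf
  rw [CechClosure.isContinuous_ofTopology_iff]
  intro p
  rw [rClosure, CechClosure.nhds_ofNhds]
  refine G.tendsto_rNhds_vertex ?_
  filter_upwards [hf p] with q hq w hw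
  rw [Realization.support_vertex, Finset.mem_singleton] at hw
  rwa [hw]

end ReflexiveGraph

/-! ## Collars on the cube -/

namespace CechClosure

variable {X : Type u} {Y : Type v}

/-- Expansion of the interval about its midpoint by the factor `1 + s`, truncated. -/
noncomputable def expandInterval (s t : unitInterval) : unitInterval :=
  projIcc 0 1 zero_le_one (1 / 2 + (1 + (s : ℝ)) * ((t : ℝ) - 1 / 2))

theorem continuous_expandInterval :
    Continuous fun p : unitInterval × unitInterval => expandInterval p.1 p.2 := by
  unfold expandInterval
  exact continuous_projIcc.comp (by fun_prop)

theorem expandInterval_zero (t : unitInterval) : expandInterval 0 t = t := by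
  simp [expandInterval]

theorem expandInterval_eq_zero {s t : unitInterval} (h : (1 + (s : ℝ)) * (2 * t - 1) ≤ -1) :
    expandInterval s t = 0 :=
  projIcc_of_le_left _ (by linarith)

theorem expandInterval_eq_one {s t : unitInterval} (h : 1 ≤ (1 + (s : ℝ)) * (2 * t - 1)) :
    expandInterval s t = 1 :=
  projIcc_of_right_le _ (by linarith)

/-- Expansion of the cube about its centre by the factor `1 + s`, truncated. -/
noncomputable def expandCube {n : ℕ} (s : unitInterval) (t : Fin n → unitInterval) :
    Fin n → unitInterval := fun i => expandInterval s (t i)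

theorem continuous_expandCube {n : ℕ} :
    Continuous fun p : unitInterval × (Fin n → unitInterval) => expandCube p.1 p.2 :=
  continuous_pi fun i => continuous_expandInterval.comp
    (continuous_fst.prodMk ((continuous_apply i).comp continuous_snd))

theorem expandCube_zero {n : ℕ} (t : Fin n → unitInterval) : expandCube 0 t = t :=
  funext fun _ => expandInterval_zero _

theorem expandCube_mem_boundary {n : ℕ} (s : unitInterval) {t : Fin n → unitInterval}
    (ht : t ∈ cubeBoundary n) : expandCube s t ∈ cubeBoundary n := by
  obtain ⟨i, hi⟩ := ht
  have := s.2.1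
  refine ⟨i, hi.imp (fun h => expandInterval_eq_zero ?_) fun h => expandInterval_eq_one ?_⟩
  · rw [h, Icc.coe_zero]; linarith
  · rw [h, Icc.coe_one]; linarith

/-- Depth at most `1/2` means that some centred coordinate has absolute value at least `1/2`;
doubling pushes it to `±1`. -/
theorem expandCube_one_mem_boundary {n : ℕ} {t : Fin n → unitInterval} (ht : cubeDepth t ≤ 1 / 2) :
    expandCube 1 t ∈ cubeBoundary n := by
  have h : ¬ ‖cubeCentre t‖ < 1 / 2 := by
    unfold cubeDepth at ht
    linarith
  rw [pi_norm_lt_iff (by norm_num)] at h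
  push Not at h
  obtain ⟨i, hi⟩ := h
  rw [Real.norm_eq_abs, le_abs] at hi
  simp only [cubeCentre] at hi
  refine ⟨i, hi.symm.imp (fun h => expandInterval_eq_zero ?_) fun h => expandInterval_eq_one ?_⟩ <;>
    rw [Icc.coe_one] <;> linarith

/-- Composition with the expansion of the cube by the factor `2`. -/
noncomputable def collar {n : ℕ} {c : CechClosure X} {x : X}
    (f : PairMap (Fin n → unitInterval) (cubeBoundary n) c x) :
    PairMap (Fin n → unitInterval) (cubeBoundary n) c x :=
  ⟨fun t => f.1 (expandCube 1 t),
    f.2.1.comp_continuous (continuous_expandCube.comp (continuous_const.prodMk continuous_id)),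
    fun _ ht => f.2.2 _ (expandCube_mem_boundary 1 ht)⟩

theorem collar_homotopic {n : ℕ} {c : CechClosure X} {x : X}
    (f : PairMap (Fin n → unitInterval) (cubeBoundary n) c x) :
    PairMap.Homotopic f (collar f) := by
  refine ⟨fun p => f.1 (expandCube p.2 p.1), ?_, fun t => ?_, fun _ => rfl,
    fun t ht s => f.2.2 _ (expandCube_mem_boundary s ht)⟩
  · rw [prod_ofTopology]
    exact f.2.1.comp_continuous
      (continuous_expandCube.comp (continuous_snd.prodMk continuous_fst))
  · simp only [expandCube_zero]

theorem collar_apply {n : ℕ} {c : CechClosure X} {x : X}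
    (f : PairMap (Fin n → unitInterval) (cubeBoundary n) c x) {t : Fin n → unitInterval}
    (ht : cubeDepth t ≤ 1 / 2) : (collar f).1 t = x :=
  f.2.2 _ (expandCube_one_mem_boundary ht)

/-- A homotopy between `f ∘ a` and `f ∘ b` may be taken stationary near the boundary of
`I^n × I`, after collaring `a` and `b`. -/
theorem exists_collared_homotopy {n : ℕ} {c : CechClosure X} {x : X}
    {a b : PairMap (Fin n → unitInterval) (cubeBoundary n) c x} (h : PairMap.Homotopic a b) :
    ∃ H : (Fin n → unitInterval) × unitInterval → X, IsContinuous (ofTopology _) c H ∧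
      (∀ u (t : unitInterval), (t : ℝ) ≤ 1 / 4 → H (u, t) = (collar a).1 u) ∧
      (∀ u (t : unitInterval), 3 / 4 ≤ (t : ℝ) → H (u, t) = (collar b).1 u) ∧
      ∀ u t, cubeDepth u ≤ 1 / 2 → H (u, t) = x := by
  obtain ⟨H, hH, h0, h1, hB⟩ := h
  rw [prod_ofTopology] at hH
  refine ⟨fun p => H (expandCube 1 p.1, expandInterval 1 p.2), hH.comp_continuous ?_,
    fun u t ht => ?_, fun u t ht => ?_, fun u t hu => hB _ (expandCube_one_mem_boundary hu) _⟩
  · exact (continuous_expandCube.comp (continuous_const.prodMk continuous_fst)).prodMk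
      (continuous_expandInterval.comp (continuous_const.prodMk continuous_snd))
  · simp only
    rw [expandInterval_eq_zero (by rw [Icc.coe_one]; linarith), h0]
    rfl
  · simp only
    rw [expandInterval_eq_one (by rw [Icc.coe_one]; linarith), h1]
    rfl

/-! ## Homotopy groups as classes of maps on cubes -/

/-- In dimension zero `collapse` is not surjective: `I^0` is a point with empty boundary, sent to
the point of `S^0` other than the base point. Based maps on `S^0` are still the same as maps on that
point, and `S^0` is discrete. -/
theorem HomotopyGroup.toCubeClasses_zero_bijective (c : CechClosure X) (x : X) :
    Function.Bijective (toCubeClasses 0 c x) := by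
  classical
  have hne : ∀ t : Fin 0 → unitInterval, collapse t ≠ Sphere.base 0 := fun t ht => by
    obtain ⟨i, -⟩ := (collapse_eq_base_iff t).1 ht
    exact i.elim0
  have hcover : ∀ p : Sphere 0, p ≠ Sphere.base 0 → p = collapse default := by
    have hsq : ∀ p : Sphere 0, p.1 0 = 1 ∨ p.1 0 = -1 := fun p => by
      have h := p.2
      rw [mem_sphere_zero_iff_norm, EuclideanSpace.norm_eq, Real.sqrt_eq_one] at h
      simpa using h
    have hneg : ∀ p : Sphere 0, p ≠ Sphere.base 0 → p.1 0 = -1 := fun p hp =>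
      (hsq p).resolve_left fun h => hp ((eq_base_iff p).2 h)
    intro p hp
    ext i
    rw [Fin.eq_zero i, hneg p hp, hneg _ (hne default)]
  have hdisc : DiscreteTopology (Sphere 0) := by
    have hfin : Finite (Sphere 0) := by
      refine Finite.of_surjective (fun b : Bool => cond b (Sphere.base 0) (collapse default)) ?_
      intro p
      by_cases hp : p = Sphere.base 0
      · exact ⟨true, hp.symm⟩
      · exact ⟨false, (hcover p hp).symm⟩
    infer_instance
  constructor
  · rintro ⟨f⟩ ⟨g⟩ h
    obtain ⟨H, hH, h0, h1, -⟩ := Quotient.exact h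
    rw [prod_ofTopology] at hH
    refine Quotient.sound ⟨fun p => if p.1 = Sphere.base 0 then x else H (default, p.2),
      ?_, ?_, ?_, ?_⟩
    · rw [prod_ofTopology, isContinuous_ofTopology_iff]
      rintro ⟨p, t⟩
      have hp : ∀ᶠ q : Sphere 0 × unitInterval in 𝓝 (p, t), q.1 = p :=
        ((isOpen_discrete {p}).preimage continuous_fst).mem_nhds rfl
      by_cases h : p = Sphere.base 0
      · refine (isContinuous_ofTopology_iff.1 (isContinuous_const c x) (p, t)).congr' ?_ |>.trans ?_
        · filter_upwards [hp] with q hq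
          rw [hq, if_pos h]
        · simp [h]
      · have hc := isContinuous_ofTopology_iff.1 (hH.comp_continuous
          (continuous_const.prodMk continuous_snd :
            Continuous fun q : Sphere 0 × unitInterval => ((default : Fin 0 → unitInterval), q.2)))
            (p, t)
        simp only [if_neg h]
        refine hc.congr' ?_
        filter_upwards [hp] with q hq
        rw [hq, if_neg h]
    · intro p
      simp only
      split_ifs with hp
      · exact (f.2.2 p hp).symm
      · rw [h0, hcover p hp]; rfl
    · intro p
      simp only
      split_ifs with hp
      · exact (g.2.2 p hp).symm
      · rw [h1, hcover p hp]; rfl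
    · intro p hp t
      exact if_pos hp
  · rintro ⟨F⟩
    refine ⟨Quotient.mk _ ⟨fun p => if p = Sphere.base 0 then x else F.1 default, ?_, ?_⟩,
      congrArg (Quotient.mk _) (Subtype.ext (funext fun t => ?_))⟩
    · rw [isContinuous_ofTopology_iff]
      intro p
      rw [nhds_discrete]
      exact (tendsto_pure_pure _ _).mono_right (c.pure_le_nhds _)
    · exact fun p hp => if_pos hp
    · simp only [toCube, if_neg (hne t)]
      rw [Subsingleton.elim t default]

theorem HomotopyGroup.bijective_map_iff {c : CechClosure X} {c' : CechClosure Y} {f : X → Y}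
    (hf : IsContinuous c c' f) (n : ℕ) (x : X) :
    Function.Bijective (HomotopyGroup.map n hf x) ↔
      Function.Bijective (PairMap.Classes.map hf x :
        CubeClasses n c x → CubeClasses n c' (f x)) := by
  have hbij : ∀ {Z : Type _} (d : CechClosure Z) (z : Z),
      Function.Bijective (toCubeClasses n d z) := fun d z => by
    cases n with
    | zero => exact toCubeClasses_zero_bijective d z
    | succ n => exact toCubeClasses_bijective n d z
  -- A local hypothesis lives in a single universe, while `X` and `Y` may lie in different ones;
  -- hence a second copy.
  have hbij' : ∀ {Z : Type _} (d : CechClosure Z) (z : Z),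
      Function.Bijective (toCubeClasses n d z) := fun d z => by
    cases n with
    | zero => exact toCubeClasses_zero_bijective d z
    | succ n => exact toCubeClasses_bijective n d z
  have hnat : toCubeClasses n c' (f x) ∘ HomotopyGroup.map n hf x =
      PairMap.Classes.map hf x ∘ toCubeClasses n c x := by
    funext a
    rcases a with ⟨a⟩
    rfl
  rw [← Function.Bijective.of_comp_iff' (hbij c' (f x)), hnat,
    Function.Bijective.of_comp_iff _ (hbij' c x)]

theorem isWeakHomotopyEquiv_of_cube {c : CechClosure X} {c' : CechClosure Y} {f : X → Y}
    (hf : IsContinuous c c' f)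
    (h : ∀ n x, Function.Bijective (PairMap.Classes.map hf x :
      CubeClasses n c x → CubeClasses n c' (f x))) (hne : Nonempty Y → Nonempty X) :
    IsWeakHomotopyEquiv c c' f :=
  ⟨hf, fun x => (HomotopyGroup.bijective_map_iff hf 0 x).2 (h 0 x),
    fun n x => (HomotopyGroup.bijective_map_iff hf (n + 1) x).2 (h (n + 1) x), hne⟩

/-- Two continuous maps which at every point admit `f p` as a common approximation of `g` are
homotopic by a jump at time `1/2`. -/
theorem homotopic_of_tendsto {A : Type*} [TopologicalSpace A] {B : Set A} {c : CechClosure X} {x : X}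
    (f g : PairMap A B c x) (h : ∀ p, Tendsto g.1 (𝓝 p) (c.nhds (f.1 p))) :
    PairMap.Homotopic f g := by
  refine ⟨fun p => if (p.2 : ℝ) ≤ 1 / 2 then f.1 p.1 else g.1 p.1, ?_, fun p => ?_, fun p => ?_,
    fun p hp t => ?_⟩
  · rw [prod_ofTopology, isContinuous_ofTopology_iff]
    rintro ⟨p, t⟩
    have hc : Continuous fun q : A × unitInterval => (q.2 : ℝ) := by fun_prop
    have hfst : Tendsto (Prod.fst : A × unitInterval → A) (𝓝 (p, t)) (𝓝 p) :=
      continuous_fst.continuousAt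
    by_cases ht : (t : ℝ) ≤ 1 / 2
    · simp only [if_pos ht]
      -- The seam `t = 1/2` belongs to `f`: nearby values of both `f` and `g` then tend to the value
      -- of `f`. The asymmetry of the hypothesis fixes this choice.
      exact Tendsto.if' ((isContinuous_ofTopology_iff.1 f.2.1 p).comp hfst) ((h p).comp hfst)
    · simp only [if_neg ht]
      refine ((isContinuous_ofTopology_iff.1 g.2.1 p).comp hfst).congr' ?_
      filter_upwards [hc.continuousAt.eventually (lt_mem_nhds (not_le.1 ht))] with q hq
      rw [if_neg (not_le.2 hq), Function.comp_apply]
  · simp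
  · have : ¬ (((1 : unitInterval) : ℝ) ≤ 1 / 2) := by norm_num
    simp only [if_neg this]
  · simp only
    split_ifs
    · exact f.2.2 p hp
    · exact g.2.2 p hp

end CechClosure

/-! ## The comparison maps on homotopy classes -/

namespace ReflexiveGraph

open CechClosure

variable {X : Type u} (G : ReflexiveGraph X)

/-- The distance from a point of `I^n × I` to the boundary, up to normalisation. -/
noncomputable def prismDepth {n : ℕ} (p : (Fin n → unitInterval) × unitInterval) : ℝ :=
  min (cubeDepth p.1) (min (p.2 : ℝ) (1 - p.2))

theorem continuous_prismDepth {n : ℕ} : Continuous (prismDepth (n := n)) :=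
  (continuous_cubeDepth.comp continuous_fst).min (by fun_prop)

theorem prismDepth_nonneg {n : ℕ} (p : (Fin n → unitInterval) × unitInterval) :
    0 ≤ prismDepth p :=
  le_min (cubeDepth_nonneg _) (le_min p.2.2.1 (sub_nonneg.2 p.2.2.2))

theorem prismDepth_of_mem_boundary {n : ℕ} {u : Fin n → unitInterval} (hu : u ∈ cubeBoundary n)
    (t : unitInterval) : prismDepth (u, t) = 0 :=
  le_antisymm ((min_le_left _ _).trans_eq ((mem_cubeBoundary_iff u).1 hu)) (prismDepth_nonneg _)

theorem prismDepth_zero {n : ℕ} (u : Fin n → unitInterval) : prismDepth (u, 0) = 0 :=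
  le_antisymm ((min_le_right _ _).trans ((min_le_left _ _).trans_eq (by simp)))
    (prismDepth_nonneg _)

theorem prismDepth_one {n : ℕ} (u : Fin n → unitInterval) : prismDepth (u, 1) = 0 :=
  le_antisymm ((min_le_right _ _).trans ((min_le_right _ _).trans_eq (by simp)))
    (prismDepth_nonneg _)

theorem prismDepth_cases {n : ℕ} {p : (Fin n → unitInterval) × unitInterval} {r : ℝ}
    (h : prismDepth p < r) : cubeDepth p.1 < r ∨ (p.2 : ℝ) < r ∨ 1 - r < (p.2 : ℝ) := by
  rcases min_lt_iff.1 h with h | h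
  · exact Or.inl h
  · rcases min_lt_iff.1 h with h | h
    · exact Or.inr (Or.inl h)
    · exact Or.inr (Or.inr (by linarith))

/-- The maps `a` for `t ≤ 1/2` and `b` for `t > 1/2`, on `I^n × I`. -/
noncomputable def prismEnds {n : ℕ} {Y : Type*} (a b : (Fin n → unitInterval) → Y)
    (p : (Fin n → unitInterval) × unitInterval) : Y :=
  if (p.2 : ℝ) ≤ 1 / 2 then a p.1 else b p.1

/-- The only possible discontinuity is at `t = 1/2`. Depth below `1/2` there forces `cubeDepth`
below `1/2`, where both collared maps are constantly the base point. -/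
theorem tendsto_prismEnds {n : ℕ} {Y : Type*} {c : CechClosure Y} {y : Y}
    {a b : PairMap (Fin n → unitInterval) (cubeBoundary n) c y}
    {p : (Fin n → unitInterval) × unitInterval} (hp : prismDepth p < 1 / 2) :
    Tendsto (prismEnds (collar a).1 (collar b).1) (𝓝 p)
      (c.nhds (prismEnds (collar a).1 (collar b).1 p)) := by
  have hc : Continuous fun q : (Fin n → unitInterval) × unitInterval => (q.2 : ℝ) := by fun_prop
  have hd : Continuous fun q : (Fin n → unitInterval) × unitInterval => cubeDepth q.1 :=
    continuous_cubeDepth.comp continuous_fst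
  have hfst : Tendsto Prod.fst (𝓝 p) (𝓝 p.1) := continuous_fst.continuousAt
  rcases prismDepth_cases hp with h | h | h
  · have hx : ∀ q : (Fin n → unitInterval) × unitInterval, cubeDepth q.1 < 1 / 2 →
        prismEnds (collar a).1 (collar b).1 q = y := fun q hq => by
      unfold prismEnds
      rw [collar_apply a (by linarith), collar_apply b (by linarith), ite_self]
    rw [hx p h]
    refine (tendsto_const_pure.mono_right (c.pure_le_nhds y)).congr' ?_
    filter_upwards [hd.continuousAt.eventually (gt_mem_nhds h)] with q hq
    exact (hx q hq).symm
  · have hx : ∀ q : (Fin n → unitInterval) × unitInterval, (q.2 : ℝ) < 1 / 2 →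
        prismEnds (collar a).1 (collar b).1 q = (collar a).1 q.1 := fun q hq =>
      if_pos (by linarith)
    rw [hx p h]
    refine ((isContinuous_ofTopology_iff.1 (collar a).2.1 p.1).comp hfst).congr' ?_
    filter_upwards [hc.continuousAt.eventually (gt_mem_nhds h)] with q hq
    exact (hx q hq).symm
  · have hx : ∀ q : (Fin n → unitInterval) × unitInterval, 1 - 1 / 2 < (q.2 : ℝ) →
        prismEnds (collar a).1 (collar b).1 q = (collar b).1 q.1 := fun q hq =>
      if_neg (by linarith)
    rw [hx p h]
    refine ((isContinuous_ofTopology_iff.1 (collar b).2.1 p.1).comp hfst).congr' ?_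
    filter_upwards [hc.continuousAt.eventually (lt_mem_nhds h)] with q hq
    exact (hx q hq).symm

variable (lo : LinearOrder X)

/-- A collared homotopy `H` between `Θ ∘ a` and `Θ ∘ b` agrees with `Θ` of the ends near the
boundary of the prism. -/
theorem eq_discreteModification_prismEnds {n : ℕ} {c : CechClosure (Realization G.vietorisRips)}
    (hf : IsContinuous c G.closure (G.discreteModification lo)) {x : Realization G.vietorisRips}
    {a b : PairMap (Fin n → unitInterval) (cubeBoundary n) c x}
    {H : (Fin n → unitInterval) × unitInterval → X}
    (h0 : ∀ u (t : unitInterval), (t : ℝ) ≤ 1 / 4 → H (u, t) = (collar (PairMap.postcomp hf a)).1 u)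
    (h1 : ∀ u (t : unitInterval), 3 / 4 ≤ (t : ℝ) → H (u, t) = (collar (PairMap.postcomp hf b)).1 u)
    (hB : ∀ u t, cubeDepth u ≤ 1 / 2 → H (u, t) = G.discreteModification lo x)
    {p : (Fin n → unitInterval) × unitInterval} (hp : prismDepth p ≤ 1 / 4) :
    H p = G.discreteModification lo (prismEnds (collar a).1 (collar b).1 p) := by
  obtain ⟨u, t⟩ := p
  have hp' : cubeDepth u ≤ 1 / 4 ∨ (t : ℝ) ≤ 1 / 4 ∨ 3 / 4 ≤ (t : ℝ) := by
    rcases min_le_iff.1 hp with h | h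
    · exact Or.inl h
    · rcases min_le_iff.1 h with h | h
      · exact Or.inr (Or.inl h)
      · simp only at h
        exact Or.inr (Or.inr (by linarith))
  rcases hp' with h | h | h
  · rw [hB u t (by linarith)]
    unfold prismEnds
    rw [collar_apply a (by simp only; linarith), collar_apply b (by simp only; linarith), ite_self]
  · rw [h0 u t h]
    simp only [prismEnds]
    rw [if_pos (by linarith)]
    rfl
  · rw [h1 u t h]
    simp only [prismEnds]
    rw [if_neg (by linarith)]
    rfl

theorem prismEnds_of_mem_boundary {n : ℕ} {Y : Type*} {c : CechClosure Y} {y : Y}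
    {a b : PairMap (Fin n → unitInterval) (cubeBoundary n) c y}
    {u : Fin n → unitInterval} (hu : u ∈ cubeBoundary n) (t : unitInterval) :
    prismEnds (collar a).1 (collar b).1 (u, t) = y := by
  simp only [prismEnds]
  rw [(collar a).2.2 u hu, (collar b).2.2 u hu, ite_self]

theorem prismEnds_zero {n : ℕ} {Y : Type*} (a b : (Fin n → unitInterval) → Y)
    (u : Fin n → unitInterval) : prismEnds a b (u, 0) = a u := by
  simp [prismEnds]

theorem prismEnds_one {n : ℕ} {Y : Type*} (a b : (Fin n → unitInterval) → Y)
    (u : Fin n → unitInterval) : prismEnds a b (u, 1) = b u := by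
  have : ¬ (((1 : unitInterval) : ℝ) ≤ 1 / 2) := by norm_num
  simp only [prismEnds, if_neg this]

theorem mk_eq_of_collar_homotopic {n : ℕ} {Y : Type*} {c : CechClosure Y} {y : Y}
    {a b : PairMap (Fin n → unitInterval) (cubeBoundary n) c y}
    (h : PairMap.Homotopic (collar a) (collar b)) :
    (Quotient.mk _ a : CubeClasses n c y) = Quotient.mk _ b :=
  (Quotient.sound (collar_homotopic a)).trans
    ((Quotient.sound h).trans (Quotient.sound (collar_homotopic b)).symm)

/-! ### Injectivity and surjectivity on homotopy classes -/

theorem isContinuous_vr_discreteModification :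
    IsContinuous G.vrClosure G.closure (G.discreteModification lo) :=
  (G.isContinuous_discreteModification lo).comp G.isContinuous_id

/-- A homotopy in the graph between `Θ ∘ a` and `Θ ∘ b` is approximated by a map into `|VR(X)|`
which has the collared `a` and `b` as its ends. -/
theorem injective_map_vr (n : ℕ) (x : Realization G.vietorisRips) :
    Function.Injective (PairMap.Classes.map (G.isContinuous_vr_discreteModification lo) x :
      CubeClasses n G.vrClosure x → CubeClasses n G.closure (G.discreteModification lo x)) := by
  rintro ⟨a⟩ ⟨b⟩ hab
  obtain ⟨H, hH, h0, h1, hB⟩ := exists_collared_homotopy (Quotient.exact hab)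
  obtain ⟨g, hg, hgA, -⟩ := G.exists_realization_approx (hasComparableCovers_cube n).prod_unitInterval
    -- With the factor `8`, `ν < 2` means depth below `1/4`, where `H` agrees with `Θ` of the
    -- prescribed ends.
    hH (ν := fun p => 8 * prismDepth p) (continuous_const.mul continuous_prismDepth)
    (fun p => mul_nonneg (by norm_num) (prismDepth_nonneg p))
    (A := prismEnds (collar a).1 (collar b).1)
    (fun p hp => by
      have := tendsto_prismEnds (a := a) (b := b) (p := p) (by linarith)
      rwa [G.vrClosure_nhds] at this)
    (fun p hp => by
      rw [G.eq_discreteModification_prismEnds lo _ h0 h1 hB (by linarith)]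
      exact G.discreteModification_mem_support lo _)
  have hgA' : ∀ p, prismDepth p = 0 → g p = prismEnds (collar a).1 (collar b).1 p :=
    fun p hp => hgA p (by rw [hp, mul_zero])
  refine mk_eq_of_collar_homotopic ⟨g, ?_, fun u => ?_, fun u => ?_, fun u hu t => ?_⟩
  · rw [prod_ofTopology]
    unfold vrClosure
    rw [isContinuous_ofTopology_iff]
    intro p
    rw [nhds_ofTopology]
    exact hg.continuousAt
  · rw [hgA' _ (prismDepth_zero u), prismEnds_zero]
  · rw [hgA' _ (prismDepth_one u), prismEnds_one]
  · rw [hgA' _ (prismDepth_of_mem_boundary hu t), prismEnds_of_mem_boundary hu]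

theorem surjective_map_vr (n : ℕ) (x : Realization G.vietorisRips) :
    Function.Surjective (PairMap.Classes.map (G.isContinuous_vr_discreteModification lo) x :
      CubeClasses n G.vrClosure x → CubeClasses n G.closure (G.discreteModification lo x)) := by
  rintro ⟨f⟩
  obtain ⟨g, hg, hgA, hgf⟩ := G.exists_realization_approx (hasComparableCovers_cube n)
    (collar f).2.1 (ν := fun p => 8 * cubeDepth p) (continuous_const.mul continuous_cubeDepth)
    (fun p => mul_nonneg (by norm_num) (cubeDepth_nonneg p)) (A := fun _ => x)
    (fun _ _ => continuousAt_const)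
    (fun p hp => by
      rw [collar_apply f (by linarith)]
      exact G.discreteModification_mem_support lo x)
  let g' : PairMap (Fin n → unitInterval) (cubeBoundary n) G.vrClosure x := ⟨g, by
    unfold vrClosure
    rw [isContinuous_ofTopology_iff]
    intro p
    rw [nhds_ofTopology]
    exact hg.continuousAt, fun u hu => hgA u (by rw [(mem_cubeBoundary_iff u).1 hu, mul_zero])⟩
  refine ⟨Quotient.mk _ g', ?_⟩
  -- `Θ (g p)` is a vertex of the carrier of `g p`, so it is adjacent to all values of the collared
  -- `f` near `p`, and the two maps differ by a jump.
  refine (Quotient.sound (homotopic_of_tendsto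
    (PairMap.postcomp (G.isContinuous_vr_discreteModification lo) g') (collar f) fun p => ?_)).trans
    (Quotient.sound (collar_homotopic f)).symm
  rw [closure_nhds, tendsto_principal]
  exact hgf p _ (G.discreteModification_mem_support lo (g p))

theorem injective_map_r (n : ℕ) (x : Realization G.vietorisRips) :
    Function.Injective (PairMap.Classes.map (G.isContinuous_discreteModification lo) x :
      CubeClasses n G.rClosure x → CubeClasses n G.closure (G.discreteModification lo x)) := by
  rintro ⟨a⟩ ⟨b⟩ hab
  obtain ⟨H, hH, h0, h1, hB⟩ := exists_collared_homotopy (Quotient.exact hab)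
  have hpos : ∀ {p : (Fin n → unitInterval) × unitInterval}, prismDepth p = 0 →
      prismDepth p < 1 / 4 := fun h => by rw [h]; norm_num
  -- No approximation is needed in `R(X)`: use the ends near the boundary and the lift of `H` by
  -- vertices inside. The strict inequality gives the seam to the vertices, whose neighbourhoods are
  -- large enough to allow the jump.
  refine mk_eq_of_collar_homotopic ⟨fun p => if prismDepth p < 1 / 4 then
    prismEnds (collar a).1 (collar b).1 p else Realization.vertex G.vietorisRips (H p),
    ?_, fun u => ?_, fun u => ?_, fun u hu t => ?_⟩
  · rw [prod_ofTopology, isContinuous_ofTopology_iff]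
    intro p
    have hv := isContinuous_ofTopology_iff.1 (G.isContinuous_vertex_comp hH) p
    rcases lt_trichotomy (prismDepth p) (1 / 4) with hp | hp | hp
    · rw [if_pos hp]
      refine (tendsto_prismEnds (by linarith)).congr' ?_
      filter_upwards [continuous_prismDepth.continuousAt.eventually (gt_mem_nhds hp)] with q hq
      rw [if_pos hq]
    · rw [if_neg hp.not_lt]
      rw [rClosure_nhds] at hv ⊢
      -- On the seam `H p` is `Θ` of the end value, a vertex of its carrier; the nearby end values
      -- have supports adjacent to it, so they lie in its closed star.
      refine Tendsto.if' (G.tendsto_rNhds_vertex ?_) hv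
      have ht := tendsto_prismEnds (a := a) (b := b) (p := p) (by linarith)
      rw [rClosure_nhds] at ht
      filter_upwards [ht.eventually (G.eventually_rNhds_adj _)] with q hq w hw
      refine hq _ ?_ w hw
      rw [G.eq_discreteModification_prismEnds lo _ h0 h1 hB hp.le]
      exact G.discreteModification_mem_support lo _
    · rw [if_neg hp.not_gt]
      refine hv.congr' ?_
      filter_upwards [continuous_prismDepth.continuousAt.eventually (lt_mem_nhds hp)] with q hq
      rw [if_neg hq.not_gt]
  · simp only [if_pos (hpos (prismDepth_zero u)), prismEnds_zero]
  · simp only [if_pos (hpos (prismDepth_one u)), prismEnds_one]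
  · simp only [if_pos (hpos (prismDepth_of_mem_boundary hu t)), prismEnds_of_mem_boundary hu]

theorem bijective_map_vr (n : ℕ) (x : Realization G.vietorisRips) :
    Function.Bijective (PairMap.Classes.map (G.isContinuous_vr_discreteModification lo) x :
      CubeClasses n G.vrClosure x → CubeClasses n G.closure (G.discreteModification lo x)) :=
  ⟨G.injective_map_vr lo n x, G.surjective_map_vr lo n x⟩

theorem map_comp_map_id (n : ℕ) (x : Realization G.vietorisRips) :
    (PairMap.Classes.map (G.isContinuous_discreteModification lo) x ∘
        PairMap.Classes.map G.isContinuous_id x :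
      CubeClasses n G.vrClosure x → CubeClasses n G.closure (G.discreteModification lo x)) =
    PairMap.Classes.map (G.isContinuous_vr_discreteModification lo) x := by
  funext a
  rcases a with ⟨a⟩
  rfl

/-- Surjectivity comes for free, because the surjection from the classes of `|VR(X)|` factors
through those of `R(X)`. -/
theorem bijective_map_r (n : ℕ) (x : Realization G.vietorisRips) :
    Function.Bijective (PairMap.Classes.map (G.isContinuous_discreteModification lo) x :
      CubeClasses n G.rClosure x → CubeClasses n G.closure (G.discreteModification lo x)) := by
  refine ⟨G.injective_map_r lo n x, Function.Surjective.of_comp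
    (g := PairMap.Classes.map G.isContinuous_id x) ?_⟩
  rw [map_comp_map_id]
  exact G.surjective_map_vr lo n x

theorem bijective_map_id (n : ℕ) (x : Realization G.vietorisRips) :
    Function.Bijective (PairMap.Classes.map G.isContinuous_id x :
      CubeClasses n G.vrClosure x → CubeClasses n G.rClosure (id x)) := by
  classical
  -- The statement involves no order; one is chosen only to have some `Θ` for the two-out-of-three
  -- argument.
  have lo : LinearOrder X := linearOrderOfSTO WellOrderingRel
  refine (Function.Bijective.of_comp_iff' (G.bijective_map_r lo n x) _).1 ?_
  rw [map_comp_map_id]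
  exact G.bijective_map_vr lo n x

/-! ### The weak homotopy equivalences and the zig-zag -/

theorem isWeakHomotopyEquiv_discreteModification :
    IsWeakHomotopyEquiv G.rClosure G.closure (G.discreteModification lo) :=
  isWeakHomotopyEquiv_of_cube (G.isContinuous_discreteModification lo) (G.bijective_map_r lo)
    fun ⟨v⟩ => ⟨Realization.vertex _ v⟩

theorem isWeakHomotopyEquiv_id : IsWeakHomotopyEquiv G.vrClosure G.rClosure id :=
  isWeakHomotopyEquiv_of_cube G.isContinuous_id G.bijective_map_id fun h => h

end ReflexiveGraph

theorem mainTheorem1 {X : Type u} (G : ReflexiveGraph X) :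
    SameWeakHomotopyType ⟨X, G.closure⟩ ⟨Realization G.vietorisRips, G.vrClosure⟩ ∧
    (∀ lo : LinearOrder X,
      CechClosure.IsWeakHomotopyEquiv G.rClosure G.closure (G.discreteModification lo)) ∧
    CechClosure.IsWeakHomotopyEquiv G.vrClosure G.rClosure id := by
  classical
  have lo : LinearOrder X := linearOrderOfSTO WellOrderingRel
  refine ⟨?_, G.isWeakHomotopyEquiv_discreteModification, G.isWeakHomotopyEquiv_id⟩
  refine Relation.EqvGen.trans _ ⟨Realization G.vietorisRips, G.rClosure⟩ _ ?_ ?_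
  · exact Relation.EqvGen.symm _ _
      (Relation.EqvGen.rel _ _ ⟨_, G.isWeakHomotopyEquiv_discreteModification lo⟩)
  · exact Relation.EqvGen.symm _ _ (Relation.EqvGen.rel _ _ ⟨_, G.isWeakHomotopyEquiv_id⟩)
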